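/- **Model.** Time is slotted. Two queues $i\in\{1,2\}$ share one server, which is at queue $m(t)$ in slot $t$. In each slot the server either stays ($a_t=1$) or switches to the other queue ($a_t=0$), so that $m(t+1)=m(t)$ if $a_t=1$ and $m(t+1)$ is the other queue if $a_t=0$. The channel $C_i(t)\in\{0,1\}$ of queue $i$ is a two-state Markov chain which changes its state in each slot with probability $\epsilon$, where $0<\epsilon\le 1/2$; its initial law is arbitrary. A number $A_i(t)\in\{0,1,2,\dots\}$ of packets arrives at queue $i$ in slot $t$; second moments are bounded, $\sup_t\mathbb E[A_i(t)^2]<\infty$, and $\mathbb E[A_i(t)\mid A_i(0),\dots,A_i(t-1)]=\lambda_i$ for all $t$ (for example, $A_i$ is i.i.d. over time with mean $\lambda_i$ and finite second moment). The four processes $A_1,A_2,C_1,C_2$ are independent. The queue lengths satisfy $Q_i(t+1)=Q_i(t)+A_i(t)-D_i(t)$, where $D_i(t)=1$ if $m(t)=i$, $a_t=1$, $C_i(t)=1$ and $Q_i(t)>0$, and $D_i(t)=0$ otherwise; $m(0)$ and $Q_1(0),Q_2(0)$ are arbitrary constants. The system is (strongly) stable if $\limsup_{t\to\infty}\frac1t\sum_{\tau=0}^{t-1}\mathbb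 E[Q_i(\tau)]<\infty$ for $i=1,2$. **Rate region.** In the saturated system (queues never empty), slot $t$ yields a departure from queue $i$ if $m(t)=i$, $a_t=1$ and $C_i(t)=1$. Let $\mathbf\Lambda_s=\mathbf\Lambda_s(\epsilon)\subset\mathbb R^2$ be the set of all pairs $(r_1,r_2)$ for which there are an initial distribution of $(m(0),C_1(0),C_2(0))$ and a policy (possibly randomized, history dependent and non-stationary) under which, for $i=1,2$, the expected number of departures from queue $i$ in the first $K$ slots, divided by $K$, converges to $r_i$ as $K\to\infty$. **Policy.** The frame-based 1-Lookahead Myopic policy with frame length $T\ge1$ uses in each slot $t\in[jT,(j+1)T)$ the queue lengths at the beginning of the frame: if the server is at queue $m$ and $n$ is the other queue, it stays if $$Q_m(jT)\bigl(C_m(t)+\mathbb E[C_m(t+1)\mid C_m(t)]\bigr)\ \ge\ Q_n(jT)\,\mathbb E[C_n(t+1)\mid C_n(t)],$$ and switches otherwise. **Theorem.** The 1-Lookahead Myopic policy achieves at least a $\gamma$-fraction of $\mathbf\Lambda_s$ with $\gamma=90\%$, asymptotically in $T$. Precisely: for every $\epsilon\in(0,1/2]$ there is a strictly decreasing function $\delta$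 of the frame length (depending only on $\epsilon$) with $\delta(T)\to0$ as $T\to\infty$, such that for every $T\ge1$ the policy with frame length $T$ stabilizes the system for all arrival rates $(\lambda_1,\lambda_2)$ such that $$(\lambda_1+\delta(T)+\xi,\ \lambda_2+\delta(T)+\xi)\in 0.9\,\mathbf\Lambda_s\quad\text{for some }\xi>0.$$ In particular, every $(\lambda_1,\lambda_2)$ with $(\lambda_1+\xi,\lambda_2+\xi)\in0.9\,\mathbf\Lambda_s$ for some $\xi>0$ is stabilized for all sufficiently large $T$. -/

import Mathlib

open MeasureTheory ProbabilityTheory Filter Topology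
open scoped ENNReal NNReal

noncomputable section

namespace SwitchingQueues

/-! Two parallel queues (indexed by `Fin 2`) and one server; `i + 1` is the queue other than `i`.
A channel is ON iff its state is `true`, and an action is `true` for "stay", `false` for
"switch". Switching takes one slot, in which no packet is received. -/

/-- Transition probabilities of the symmetric two-state (Gilbert-Elliott) channel. -/
def chanProb (ε : ℝ) (c c' : Bool) : ℝ := if c = c' then 1 - ε else ε

/-- The indicator of the ON state. -/
def isOn (c : Bool) : ℝ := if c = true then 1 else 0

/-- Position of the server in the next slot. -/
def nextServer (m : Fin 2) (stay : Bool) : Fin 2 := if stay = true then m else m + 1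

/-! ### The saturated system and its rate region -/

/-- A state of the saturated system: server position and the two channel states. -/
abbrev State : Type := Fin 2 × (Fin 2 → Bool)

/-- `P(s' | s, a)`: the server moves deterministically, the two channels independently. -/
def stateProb (ε : ℝ) (s : State) (a : Bool) (s' : State) : ℝ :=
  if s'.1 = nextServer s.1 a then ∏ i, chanProb ε (s.2 i) (s'.2 i) else 0

/-- The departure from queue `i` in the saturated system in state `s` under action `a`. -/
def reward (i : Fin 2) (s : State) (a : Bool) : ℝ :=
  if s.1 = i ∧ a = true ∧ s.2 i = true then 1 else 0

/-- A history dependent, randomized, possibly non-stationary policy: given the past states and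
actions (latest first) and the current state, the probability of staying. -/
abbrev Policy : Type := List (State × Bool) → State → unitInterval

/-- The probability of action `a` when "stay" has probability `p`. -/
def actionProb (p : unitInterval) (a : Bool) : ℝ := if a = true then (p : ℝ) else 1 - (p : ℝ)

/-- The expected number of departures from queue `i` in the next `K` slots of the saturated system
under `π`, given the past `h` and the current state `s`. -/
def expDepartures (ε : ℝ) (π : Policy) (i : Fin 2) : ℕ → List (State × Bool) → State → ℝ
  | 0, _, _ => 0
  | K + 1, h, s => ∑ a : Bool, actionProb (π h s) a *
      (reward i s a + ∑ s' : State, stateProb ε s a s' * expDepartures ε π i K ((s, a) :: h) s')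

/-- `Λ_s`: all pairs of time average expected departure rates that are obtained in the saturated
system under some policy (and some distribution `p` of the initial state). -/
def rateRegion (ε : ℝ) : Set (Fin 2 → ℝ) :=
  {r | ∃ π : Policy, ∃ p ∈ stdSimplex ℝ State, ∀ i : Fin 2,
    Tendsto (fun K : ℕ => (∑ s, p s * expDepartures ε π i K [] s) / (K : ℝ)) atTop (𝓝 (r i))}

/-- The rates strictly inside the `δ`-stripped `γ`-fraction of `Λ`: those `lam` with
`lam + (δ, δ) + (ξ, ξ) ∈ γ Λ` for some `ξ > 0`. -/
def strictlyInside (γ δ : ℝ) (Λ : Set (Fin 2 → ℝ)) : Set (Fin 2 → ℝ) :=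
  {lam | ∃ ξ > 0, ∃ r ∈ Λ, ∀ i, lam i + δ + ξ = γ * r i}

/-! ### The frame-based 1-Lookahead Myopic policy and the queues -/

/-- `E[C(t+1) | C(t) = c]`. -/
def predictOn (ε : ℝ) (c : Bool) : ℝ := ∑ c' : Bool, chanProb ε c c' * isOn c'

open Classical in
/-- The action of the 1-Lookahead Myopic policy, with `w` the queue lengths at the beginning of the
frame, `m` the position of the server and `c` the channel states: stay iff the weight of the current
queue is at least that of the other one. -/
def myopicStay (ε : ℝ) (w : Fin 2 → ℕ) (m : Fin 2) (c : Fin 2 → Bool) : Bool :=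
  decide ((w (m + 1) : ℝ) * predictOn ε (c (m + 1)) ≤
    (w m : ℝ) * (isOn (c m) + predictOn ε (c m)))

/-- The departure from queue `i` in a slot: one packet is received if the server is at queue `i` and
stays, the channel is ON, and the queue is not empty. -/
def departure (i m : Fin 2) (stay : Bool) (c : Fin 2 → Bool) (q : Fin 2 → ℕ) : ℕ :=
  if m = i ∧ stay = true ∧ c i = true ∧ 0 < q i then 1 else 0

/-- Server position and queue lengths at the beginning of slot `t` under the 1-Lookahead Myopic
policy with frames of `T` slots, initial position `m₀`, initial queue lengths `q₀`, arrivals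
`a t i` and channel states `c t i`. The frame that contains slot `t` begins at slot `T * (t / T)`. -/
def myopicRun (ε : ℝ) (T : ℕ) (m₀ : Fin 2) (q₀ : Fin 2 → ℕ) (a : ℕ → Fin 2 → ℕ)
    (c : ℕ → Fin 2 → Bool) : ℕ → Fin 2 × (Fin 2 → ℕ)
  | 0 => (m₀, q₀)
  | t + 1 =>
    let m := (myopicRun ε T m₀ q₀ a c t).1
    let q := (myopicRun ε T m₀ q₀ a c t).2
    let w := (myopicRun ε T m₀ q₀ a c (T * (t / T))).2
    let stay := myopicStay ε w m (c t)
    (nextServer m stay, fun i => q i + a t i - departure i m stay (c t) q)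
  termination_by t => t
  decreasing_by
    all_goals first | exact Nat.lt_succ_self t | exact Nat.lt_succ_of_le (Nat.mul_div_le t T)

/-! ### The random input and stability -/

variable {Ω : Type*} [MeasurableSpace Ω]

/-- `A t` is the number of packets that arrive in slot `t`: the mean given the arrivals of the
earlier slots is `lam`, and the second moments are bounded. (Every i.i.d. sequence with mean `lam`
and finite second moment is of this kind.) -/
structure IsArrivalProcess (μ : Measure Ω) (lam : ℝ) (A : ℕ → Ω → ℕ) : Prop where
  measurable : ∀ t, Measurable (A t)
  mean : ∀ t, μ[fun ω => (A t ω : ℝ) | ⨆ s, ⨆ _ : s < t,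
    MeasurableSpace.comap (A s) inferInstance] =ᵐ[μ] fun _ => lam
  second_moment : ∃ B : ℝ≥0, ∀ t, ∫⁻ ω, (A t ω : ℝ≥0∞) ^ 2 ∂μ ≤ B

/-- `C` is a two-state Markov chain with switching probability `ε` (and any initial law). -/
structure IsChannelProcess (μ : Measure Ω) (ε : ℝ) (C : ℕ → Ω → Bool) : Prop where
  measurable : ∀ t, Measurable (C t)
  markov : ∀ (t : ℕ) (c : ℕ → Bool), μ.real {ω | ∀ s ≤ t + 1, C s ω = c s} =
    μ.real {ω | ∀ s ≤ t, C s ω = c s} * chanProb ε (c t) (c (t + 1))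

/-- The arrival processes `A 0`, `A 1` with rates `lam 0`, `lam 1` and the channel processes `C 0`,
`C 1`; the four processes are independent. -/
structure IsSystemInput (μ : Measure Ω) (ε : ℝ) (lam : Fin 2 → ℝ)
    (A : Fin 2 → ℕ → Ω → ℕ) (C : Fin 2 → ℕ → Ω → Bool) : Prop where
  arrival : ∀ i, IsArrivalProcess μ (lam i) (A i)
  channel : ∀ i, IsChannelProcess μ ε (C i)
  indep : iIndep (Sum.elim
    (fun i : Fin 2 => MeasurableSpace.comap (fun (ω : Ω) (t : ℕ) => A i t ω) inferInstance)
    (fun i : Fin 2 => MeasurableSpace.comap (fun (ω : Ω) (t : ℕ) => C i t ω) inferInstance)) μ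

/-- Strong stability: `limsup_t (1/t) ∑_{τ<t} E[Q(τ)] < ∞` (expectations in `[0, ∞]`). -/
def StronglyStable (μ : Measure Ω) (Q : ℕ → Ω → ℕ) : Prop :=
  limsup (fun t : ℕ => (∑ τ ∈ Finset.range t, ∫⁻ ω, (Q τ ω : ℝ≥0∞) ∂μ) / (t : ℝ≥0∞)) atTop < ⊤

end SwitchingQueues

end

noncomputable section

namespace SwitchingQueues

/-! Fix queue lengths `W ≥ w` as weights. The saturated system is then an average-reward Markov
decision process, and both halves of the argument use potentials (relative value functions). If
reward plus expected increment of a potential is at most `g` for every state and action, then every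
rate pair has weighted value at most `g` (`rateRegion_le`). If it is at least `g` under the myopic
action, the myopic policy collects at least `g` per slot, up to a boundary term of the size of the
potential.

Upper bounds: `phiOne` and `phiSum` give r + ε/(1-ε) s ≤ 1/2 and r + s ≤ 3/4 - ε/2, and with s ≥ 0
no other fact about the region is needed. Lower bounds: within a frame the weights are frozen, and
the ratio w/W determines the regime. For w/W ≤ ε/(1-ε) the server settles at the longer queue, and
for w = W the myopic action attains the bound on the sum; both are optimal. In between, the action
is `rareStay` or `oftenStay`, whose rates are found exactly by solving Poisson equations;
`gain_rare_ge` and `gain_often_ge` compare them with the upper bounds and yield the factor 9/10.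
`exists_potential` collects the cases, with potentials bounded by c(W + w), where c depends on ε
only.

Stability follows from the Lyapunov function ∑ Q_i² sampled at frame starts. Over a frame, the drift
inequality is integrated slot by slot with the Markov property of the channels
(`integral_next_channel`), and the potential telescopes. Its boundary term, at most 2c ∑ E[Q_i], is
paid for by Tδ(T), which is why δ(T) is of order 1/T. Arrivals enter only through E[Q_i A_i] = λ_i
E[Q_i] and second moments, and an empty queue costs at most T per slot since its weight is then at
most T. The surplus ξ makes the drift negative (`frame_drift`), and summing over frames bounds the
averages of E[Q_i]. -/

/-! ### Potentials seen from one of the queues -/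

/-- A function of the state that depends on whether the server is at queue `x`, on the channel of
queue `x` and on the other channel. -/
def potential (x : Fin 2) (φ : Bool → Bool → Bool → ℝ) (s : State) : ℝ :=
  φ (decide (s.1 = x)) (s.2 x) (s.2 (x + 1))

/-- The reward with weight `W` for the queue `x` and `w` for the other queue, plus the expected
increment of the potential `φ`, when the server is (`p`) or is not (`!p`) at queue `x` and takes
action `a`, and the channels are in the states `b` and `d`. -/
def drift (ε W w : ℝ) (φ : Bool → Bool → Bool → ℝ) (p b d a : Bool) : ℝ :=
  (if a = true then (if p = true then W * isOn b else w * isOn d) else 0) +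
    (∑ b' : Bool, ∑ d' : Bool, chanProb ε b b' * chanProb ε d d' * φ (p == a) b' d') - φ p b d

lemma sum_state (f : State → ℝ) :
    ∑ s, f s = ∑ m : Fin 2, ∑ b : Bool, ∑ d : Bool, f (m, ![b, d]) := by
  rw [Fintype.sum_prod_type]
  refine Finset.sum_congr rfl fun m _ => ?_
  rw [← (finTwoArrowEquiv Bool).symm.sum_comp, Fintype.sum_prod_type]
  rfl

/-- The model is symmetric in the two queues, so one Boolean formula serves both choices of `x`. The
new position indicator is `p == a`, as staying keeps `p` and switching negates it. All later
potential inequalities thus become finite checks. -/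
lemma drift_eq (ε : ℝ) (v : Fin 2 → ℝ) (x : Fin 2) (φ : Bool → Bool → Bool → ℝ) (s : State)
    (a : Bool) :
    ∑ i, v i * reward i s a + ∑ s', stateProb ε s a s' * potential x φ s' - potential x φ s =
      drift ε (v x) (v (x + 1)) φ (decide (s.1 = x)) (s.2 x) (s.2 (x + 1)) a := by
  obtain ⟨m, c⟩ := s
  rw [sum_state]
  generalize hb : c 0 = b
  generalize hd : c 1 = d
  fin_cases x <;> fin_cases m <;> cases a <;> cases b <;> cases d <;>
    simp [potential, drift, reward, stateProb, nextServer, isOn, Fin.sum_univ_two,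
      hb, hd] <;> ring

lemma chanProb_nonneg {ε : ℝ} (h₀ : 0 < ε) (h₁ : ε ≤ 1 / 2) (c c' : Bool) :
    0 ≤ chanProb ε c c' := by
  unfold chanProb; split_ifs <;> linarith

lemma stateProb_nonneg {ε : ℝ} (h₀ : 0 < ε) (h₁ : ε ≤ 1 / 2) (s : State) (a : Bool) (s' : State) :
    0 ≤ stateProb ε s a s' := by
  unfold stateProb
  split_ifs
  · exact Finset.prod_nonneg fun i _ => chanProb_nonneg h₀ h₁ _ _
  · exact le_rfl

lemma sum_stateProb (ε : ℝ) (s : State) (a : Bool) : ∑ s', stateProb ε s a s' = 1 := by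
  obtain ⟨m, c⟩ := s
  rw [sum_state]
  generalize hb : c 0 = b
  generalize hd : c 1 = d
  fin_cases m <;> cases a <;> cases b <;> cases d <;>
    simp [stateProb, nextServer, chanProb, hb, hd] <;> ring

lemma actionProb_nonneg (p : unitInterval) (a : Bool) : 0 ≤ actionProb p a := by
  unfold actionProb; split_ifs
  · exact p.2.1
  · linarith [p.2.2]

lemma sum_actionProb (p : unitInterval) : ∑ a, actionProb p a = 1 := by
  simp [actionProb]

/-- A potential whose drift is at most `g` bounds the weighted departures in `K` slots. -/
lemma sum_expDepartures_le {ε : ℝ} (h₀ : 0 < ε) (h₁ : ε ≤ 1 / 2) {v : Fin 2 → ℝ} {g M : ℝ}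
    {h : State → ℝ} (hM : ∀ s, -M ≤ h s)
    (hg : ∀ s a, ∑ i, v i * reward i s a + ∑ s', stateProb ε s a s' * h s' - h s ≤ g)
    (π : Policy) (K : ℕ) : ∀ (l : List (State × Bool)) (s : State),
    ∑ i, v i * expDepartures ε π i K l s ≤ K * g + h s + M := by
  induction K with
  | zero => intro l s; simp [expDepartures]; linarith [hM s]
  | succ K ih =>
    intro l s
    have step : ∀ a, ∑ i, v i * (reward i s a + ∑ s', stateProb ε s a s' *
        expDepartures ε π i K ((s, a) :: l) s') ≤ (K + 1) * g + h s + M := by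
      intro a
      have h2 : ∑ i, v i * (reward i s a + ∑ s', stateProb ε s a s' *
          expDepartures ε π i K ((s, a) :: l) s') = ∑ i, v i * reward i s a +
          ∑ s', stateProb ε s a s' * ∑ i, v i * expDepartures ε π i K ((s, a) :: l) s' := by
        simp only [mul_add, Finset.sum_add_distrib, Finset.mul_sum]
        congr 1
        rw [Finset.sum_comm]
        refine Finset.sum_congr rfl fun _ _ => Finset.sum_congr rfl fun _ _ => by ring
      have h3 : ∑ s', stateProb ε s a s' * ∑ i, v i * expDepartures ε π i K ((s, a) :: l) s' ≤
          ∑ s', stateProb ε s a s' * (K * g + h s' + M) :=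
        Finset.sum_le_sum fun s' _ =>
          mul_le_mul_of_nonneg_left (ih _ _) (stateProb_nonneg h₀ h₁ _ _ _)
      have h4 : ∑ s', stateProb ε s a s' * (K * g + h s' + M) =
          ∑ s', stateProb ε s a s' * h s' + (K * g + M) := by
        calc _ = ∑ s', (stateProb ε s a s' * h s' + stateProb ε s a s' * (K * g + M)) :=
              Finset.sum_congr rfl fun _ _ => by ring
          _ = _ := by rw [Finset.sum_add_distrib, ← Finset.sum_mul, sum_stateProb, one_mul]
      rw [h2]
      linarith [hg s a]
    calc ∑ i, v i * expDepartures ε π i (K + 1) l s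
        = ∑ a, actionProb (π l s) a * ∑ i, v i * (reward i s a + ∑ s', stateProb ε s a s' *
            expDepartures ε π i K ((s, a) :: l) s') := by
          simp only [expDepartures, Finset.mul_sum (s := (Finset.univ : Finset (Fin 2)))]
          rw [Finset.sum_comm]
          refine Finset.sum_congr rfl fun i _ => ?_
          rw [Finset.mul_sum]
          refine Finset.sum_congr rfl fun a _ => by ring
      _ ≤ ∑ a, actionProb (π l s) a * ((K + 1) * g + h s + M) :=
          Finset.sum_le_sum fun a _ => mul_le_mul_of_nonneg_left (step a) (actionProb_nonneg _ _)
      _ = _ := by rw [← Finset.sum_mul, sum_actionProb]; push_cast; ring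

/-- Weak duality for average rewards: the potential telescopes along any policy, and the bounded
remainder `2 * M` vanishes after division by `K`. -/
lemma rateRegion_le {ε : ℝ} (h₀ : 0 < ε) (h₁ : ε ≤ 1 / 2) {v : Fin 2 → ℝ} {g : ℝ} {h : State → ℝ}
    (hg : ∀ s a, ∑ i, v i * reward i s a + ∑ s', stateProb ε s a s' * h s' - h s ≤ g)
    {r : Fin 2 → ℝ} (hr : r ∈ rateRegion ε) : ∑ i, v i * r i ≤ g := by
  obtain ⟨π, p, ⟨hp, hp1⟩, hlim⟩ := hr
  obtain ⟨M, hM⟩ : ∃ M, ∀ s, |h s| ≤ M :=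
    ⟨∑ s, |h s|, fun s => Finset.single_le_sum (f := fun s => |h s|) (fun _ _ => abs_nonneg _)
      (Finset.mem_univ s)⟩
  have h1 : Tendsto (fun K : ℕ => ∑ i, v i * ((∑ s, p s * expDepartures ε π i K [] s) / (K : ℝ)))
      atTop (𝓝 (∑ i, v i * r i)) := tendsto_finsetSum _ fun i _ => (hlim i).const_mul _
  have h2 : Tendsto (fun K : ℕ => g + (2 * M) / (K : ℝ)) atTop (𝓝 (g + 0)) :=
    tendsto_const_nhds.add (tendsto_const_div_atTop_nhds_zero_nat _)
  rw [add_zero] at h2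
  refine le_of_tendsto_of_tendsto h1 h2 ?_
  filter_upwards [eventually_gt_atTop 0] with K hK
  have hK' : (0 : ℝ) < K := by exact_mod_cast hK
  have h3 : ∑ i, v i * ((∑ s, p s * expDepartures ε π i K [] s) / (K : ℝ)) =
      (∑ s, p s * ∑ i, v i * expDepartures ε π i K [] s) / K := by
    simp only [Finset.mul_sum, Finset.sum_div]
    rw [Finset.sum_comm]
    refine Finset.sum_congr rfl fun _ _ => Finset.sum_congr rfl fun _ _ => by ring
  have h4 : ∑ s, p s * ∑ i, v i * expDepartures ε π i K [] s ≤ ∑ s, p s * (K * g + 2 * M) := by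
    refine Finset.sum_le_sum fun s _ => mul_le_mul_of_nonneg_left ?_ (hp s)
    have := sum_expDepartures_le h₀ h₁ (M := M) (fun s => (abs_le.1 (hM s)).1) hg π K [] s
    linarith [(abs_le.1 (hM s)).2]
  rw [← Finset.sum_mul, hp1, one_mul] at h4
  rw [h3, div_le_iff₀ hK', add_mul, div_mul_cancel₀ _ hK'.ne']
  linarith

/-! ### Two inequalities for the rate region -/

/-- The potential for the weights `1` and `ε / (1 - ε)`. -/
def phiOne (ε : ℝ) (p b d : Bool) : ℝ :=
  if p = true then (if b = true then 1 / (4 * ε) else -1 / (4 * ε))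
  else (if b = true then 1 / (4 * ε) - 1 else -1 / (4 * ε)) + ε / (1 - ε) * isOn d

/-- The potential for equal weights. -/
def phiSum (ε : ℝ) (p b d : Bool) : ℝ :=
  match b, d with
  | true, true => 1 / (4 * ε) - (1 - 2 * ε) / (16 * ε * (1 - ε))
  | false, false => -1 / (4 * ε) - (1 - 2 * ε) / (16 * ε * (1 - ε))
  | true, false => (if p = true then 1 / 2 else -1 / 2) + (1 - 2 * ε) / (16 * ε * (1 - ε))
  | false, true => (if p = true then -1 / 2 else 1 / 2) + (1 - 2 * ε) / (16 * ε * (1 - ε))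

/-- A channel is ON half of the time, so always serving the first queue earns 1/2. The weight
ε/(1-ε) is the break-even point: with the server at an OFF first queue and the other channel ON,
staying and switching both have drift exactly 1/2. -/
lemma drift_phiOne_le {ε : ℝ} (h₀ : 0 < ε) (h₁ : ε ≤ 1 / 2) (p b d a : Bool) :
    drift ε 1 (ε / (1 - ε)) (phiOne ε) p b d a ≤ 1 / 2 := by
  have h2 : 0 < 1 - ε := by linarith
  have h3 : 0 ≤ 1 - 2 * ε := by linarith
  rw [← sub_nonneg]
  cases p <;> cases b <;> cases d <;> cases a <;>
    simp [drift, phiOne, isOn, chanProb] <;> field_simp <;> nlinarith [mul_pos h₀ h2, mul_nonneg h₀.le h3, mul_nonneg h2.le h3, mul_nonneg (mul_pos h₀ h2).le h3, mul_nonneg (mul_pos h₀ h₀).le h3, mul_pos h₀ h₀, mul_pos (mul_pos h₀ h₀) h2]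

/-- Some channel is ON with frequency 3/4. The loss ε/2 is the frequency of slots in which only the
other channel is ON, when the server leaves exactly in those slots. -/
lemma drift_phiSum_le {ε : ℝ} (h₀ : 0 < ε) (h₁ : ε ≤ 1 / 2) (p b d a : Bool) :
    drift ε 1 1 (phiSum ε) p b d a ≤ 3 / 4 - ε / 2 := by
  have h2 : 0 < 1 - ε := by linarith
  have h3 : 0 ≤ 1 - 2 * ε := by linarith
  cases p <;> cases b <;> cases d <;> cases a <;>
    simp [drift, phiSum, isOn, chanProb] <;> field_simp <;> nlinarith [mul_pos h₀ h2, mul_nonneg h₀.le h3, mul_nonneg h2.le h3, mul_nonneg (mul_pos h₀ h2).le h3, mul_nonneg (mul_pos h₀ h₀).le h3, mul_pos h₀ h₀, mul_pos (mul_pos h₀ h₀) h2]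

/-! ### Potentials for the myopic policy -/

/-- Departures of the two queues can be analysed separately, and their potentials combined linearly
in the weights. -/
lemma drift_add (ε W w : ℝ) (φ ψ : Bool → Bool → Bool → ℝ) (p b d a : Bool) :
    drift ε W w (fun p b d => W * φ p b d + w * ψ p b d) p b d a =
      W * drift ε 1 0 φ p b d a + w * drift ε 0 1 ψ p b d a := by
  cases a <;> cases p <;> simp [drift] <;> ring

open Classical in
/-- The myopic action, as seen from a queue of length `W`; the other queue has length `w`. -/
def localStay (ε W w : ℝ) (p b d : Bool) : Bool :=
  if p = true then decide (w * predictOn ε d ≤ W * (isOn b + predictOn ε b))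
  else decide (W * predictOn ε b ≤ w * (isOn d + predictOn ε d))

lemma myopicStay_eq (ε : ℝ) (w : Fin 2 → ℕ) (x m : Fin 2) (c : Fin 2 → Bool) :
    myopicStay ε w m c = localStay ε (w x) (w (x + 1)) (decide (m = x)) (c x) (c (x + 1)) := by
  fin_cases x <;> fin_cases m <;> simp [myopicStay, localStay]

lemma predictOn_true (ε : ℝ) : predictOn ε true = 1 - ε := by simp [predictOn, chanProb, isOn]

lemma predictOn_false (ε : ℝ) : predictOn ε false = ε := by simp [predictOn, chanProb, isOn]

/-- The potential of the policy that stays at the longer queue. -/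
def psiStay (ε : ℝ) (p b d : Bool) : ℝ :=
  if p = true then (if b = true then 1 / (4 * ε) else -1 / (4 * ε))
  else (if d = true then -3 / (4 * ε) else -1 / (4 * ε))

/-- Departures from the longer queue, when the server stays at the shorter queue iff only the
channel of that queue is ON. -/
def psiRareLong (ε : ℝ) (p b d : Bool) : ℝ :=
  match p, b, d with
  | _, false, false => 0
  | _, false, true => (-3 / 8 + ε / 4) / (1 - ε)
  | true, true, false => (1 / 2 - 3 / 8 * ε - ε ^ 2 / 4) / (ε * (1 - ε))
  | true, true, true => 1 / (2 * ε)
  | false, true, false => (1 / 2 - 11 / 8 * ε + 3 / 4 * ε ^ 2) / (ε * (1 - ε))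
  | false, true, true => 1 / (2 * ε) - 1

/-- Departures from the shorter queue, when the server stays there iff only its channel is ON. -/
def psiRareShort (ε : ℝ) (p b d : Bool) : ℝ :=
  match p, b, d with
  | true, false, true => (3 / 8 - 5 / 8 * ε + ε ^ 2 / 4) / ε
  | false, false, true => (3 / 8 + 3 / 8 * ε + ε ^ 2 / 4) / ε
  | _, true, false => (-1 / 8 + 3 / 8 * ε - ε ^ 2 / 4) / ε
  | _, _, _ => 0

/-- Departures from the longer queue, when the server stays at the shorter queue iff the channel of
that queue is ON. -/
def psiOftenLong (ε : ℝ) (p b d : Bool) : ℝ :=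
  match p, b, d with
  | _, false, false => 0
  | _, false, true => (-3 / 8 + ε / 4) / (ε * (1 - ε) * (2 - ε))
  | true, true, false => (9 / 8 - 7 / 4 * ε + ε ^ 2 / 2) / (ε * (1 - ε) * (2 - ε))
  | true, true, true => 1 / (2 * ε)
  | false, true, false =>
    (9 / 8 - 15 / 4 * ε + 7 / 2 * ε ^ 2 - ε ^ 3) / (ε * (1 - ε) * (2 - ε))
  | false, true, true => (-3 / 2 + ε) / (2 - ε)

/-- Departures from the shorter queue, when the server stays there iff its channel is ON. -/
def psiOftenShort (ε : ℝ) (p b d : Bool) : ℝ :=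
  match p, b, d with
  | true, false, true => (9 / 8 - 3 / 2 * ε + ε ^ 2 / 2) / (ε * (2 - ε))
  | false, false, true => (9 / 8 + ε / 2 - ε ^ 2 / 2) / (ε * (2 - ε))
  | _, true, false => (-3 / 8 + ε - ε ^ 2 / 2) / (ε * (2 - ε))
  | false, true, true => (1 + ε - ε ^ 2) / (ε * (2 - ε))
  | _, _, _ => 0

/-- Stay unless only the other channel is ON; stay at the second queue only if only its channel
is ON. -/
def rareStay (p b d : Bool) : Bool := if p = true then b || !d else !b && d

/-- Stay at the first queue unless only the other channel is ON; stay at the second queue iff its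
channel is ON. -/
def oftenStay (p b d : Bool) : Bool := if p = true then b || !d else d

/-- A Poisson equation: the drift is the same in all states, so the constant is the exact departure
rate of the stationary policy. -/
lemma drift_psiRareLong {ε : ℝ} (h₀ : 0 < ε) (h₁ : ε < 1) (p b d : Bool) :
    drift ε 1 0 (psiRareLong ε) p b d (rareStay p b d) = 1 / 2 - ε / 4 := by
  have h2 : 1 - ε ≠ 0 := by linarith
  have h3 : 2 - ε ≠ 0 := by linarith
  cases p <;> cases b <;> cases d <;> simp [drift, rareStay, psiRareLong, isOn, chanProb] <;>
    field_simp <;> ring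

lemma drift_psiRareShort {ε : ℝ} (h₀ : 0 < ε) (h₁ : ε < 1) (p b d : Bool) :
    drift ε 0 1 (psiRareShort ε) p b d (rareStay p b d) = (1 - ε) ^ 2 / 4 := by
  have h2 : 1 - ε ≠ 0 := by linarith
  have h3 : 2 - ε ≠ 0 := by linarith
  cases p <;> cases b <;> cases d <;> simp [drift, rareStay, psiRareShort, isOn, chanProb] <;>
    field_simp <;> ring

lemma drift_psiOftenLong {ε : ℝ} (h₀ : 0 < ε) (h₁ : ε < 1) (p b d : Bool) :
    drift ε 1 0 (psiOftenLong ε) p b d (oftenStay p b d) = (3 / 4 - ε / 2) / (2 - ε) := by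
  have h2 : 1 - ε ≠ 0 := by linarith
  have h3 : 2 - ε ≠ 0 := by linarith
  cases p <;> cases b <;> cases d <;> simp [drift, oftenStay, psiOftenLong, isOn, chanProb] <;>
    field_simp <;> ring

/-- With `drift_psiOftenLong` the two rates add up to 3/4 - ε/2, so `oftenStay` is optimal for equal
weights. -/
lemma drift_psiOftenShort {ε : ℝ} (h₀ : 0 < ε) (h₁ : ε < 1) (p b d : Bool) :
    drift ε 0 1 (psiOftenShort ε) p b d (oftenStay p b d) =
      (3 / 4 - ε / 2) * (1 - ε) / (2 - ε) := by
  have h2 : 1 - ε ≠ 0 := by linarith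
  have h3 : 2 - ε ≠ 0 := by linarith
  cases p <;> cases b <;> cases d <;> simp [drift, oftenStay, psiOftenShort, isOn, chanProb] <;>
    field_simp <;> ring

/-! ### The myopic action in each range of the ratio of the weights -/

lemma drift_smul (ε k W w : ℝ) (φ : Bool → Bool → Bool → ℝ) (p b d a : Bool) :
    drift ε (k * W) (k * w) (fun p b d => k * φ p b d) p b d a = k * drift ε W w φ p b d a := by
  cases a <;> cases p <;> simp [drift] <;> ring

/-- For equal weights every myopic action attains the maximal drift of `phiSum`, so the policy is
optimal for the sum of the rates. -/
lemma drift_phiSum_localStay {ε W : ℝ} (h₀ : 0 < ε) (h₁ : ε ≤ 1 / 2) (hW : 0 ≤ W)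
    (p b d : Bool) :
    W * (3 / 4 - ε / 2) ≤ drift ε W W (fun p b d => W * phiSum ε p b d) p b d
      (localStay ε W W p b d) := by
  have h2 : 1 - ε ≠ 0 := by linarith
  have key := drift_smul ε W 1 1 (phiSum ε) p b d (localStay ε W W p b d)
  rw [mul_one] at key
  rw [key]
  rcases hW.eq_or_lt with rfl | hW
  · simp
  refine mul_le_mul_of_nonneg_left ?_ hW.le
  have hlt : ∀ y : ℝ, W * y ≤ W * ε ↔ y ≤ ε := fun y => mul_le_mul_iff_right₀ hW
  have hlt' : ∀ y z : ℝ, W * y ≤ W * (1 + z) ↔ y ≤ 1 + z := fun y z => mul_le_mul_iff_right₀ hW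
  have e2 : ε ≤ 1 + (1 - ε) := by linarith
  -- At ε = 1/2 the two predictions coincide, and the tie makes the server stay where for ε < 1/2 it
  -- would leave.
  rcases h₁.eq_or_lt with rfl | h₁
  · cases p <;> cases b <;> cases d <;>
      simp [localStay, predictOn_true, predictOn_false, isOn, hlt', drift, phiSum,
        chanProb] <;> norm_num [hlt', hW.le]
  · have e3 : ¬ 1 - ε ≤ ε := by linarith
    cases p <;> cases b <;> cases d <;>
      simp [localStay, predictOn_true, predictOn_false, isOn, hlt, hlt', drift, phiSum,
        chanProb, e2, e3] <;> refine le_of_eq ?_ <;> field_simp <;> ring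

/-- Below the break-even ratio the server never leaves the longer queue, and leaves the shorter one
as soon as its channel is OFF. Serving the longer queue alone earns W/2. -/
lemma drift_psiStay_localStay {ε W w : ℝ} (h₀ : 0 < ε) (h₁ : ε ≤ 1 / 2) (hw : 0 ≤ w)
    (hlt : w < W) (hle : w * (1 - ε) ≤ ε * W) (p b d : Bool) :
    W / 2 ≤ drift ε W w (fun p b d => W * psiStay ε p b d) p b d (localStay ε W w p b d) := by
  have hW : 0 < W := hw.trans_lt hlt
  have h2 : 0 < 1 - ε := by linarith
  have f1 : w * (1 - ε) ≤ W * (1 + (1 - ε)) := by nlinarith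
  have f2 : w * (1 - ε) ≤ W * ε := by linarith
  have f3 : w * ε ≤ W * (1 + (1 - ε)) := by nlinarith
  have f4 : w * ε ≤ W * ε := by nlinarith
  have f5 : w * ε < W * ε := by nlinarith
  have f6 : w * ε < W * (1 - ε) := by nlinarith
  cases p
  · cases d
    · have : localStay ε W w false b false = false := by
        cases b <;> simp [localStay, predictOn_true, predictOn_false, isOn, f5, f6]
      rw [this]
      cases b <;> simp [drift, psiStay, chanProb] <;> field_simp <;> nlinarith
    -- Either action can be myopic here. The low value -3/(4ε) makes both drifts at least W/2, so no
    -- case distinction on the weights is needed.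
    · cases localStay ε W w false b true <;> cases b <;>
        simp [drift, psiStay, isOn, chanProb] <;> field_simp <;> nlinarith
  · have : localStay ε W w true b d = true := by
      cases b <;> cases d <;> simp [localStay, predictOn_true, predictOn_false, isOn] <;> assumption
    rw [this]
    cases b <;> cases d <;> simp [drift, psiStay, isOn, chanProb] <;> field_simp <;> nlinarith

/-- Above the break-even ratio only one decision still depends on the weights: at the shorter queue
with both channels ON, W(1-ε) is compared with w(2-ε). -/
lemma localStay_eq_rareStay {ε W w : ℝ} (h₀ : 0 < ε) (hw : 0 ≤ w) (hlt : w < W)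
    (hle : ε * W < w * (1 - ε)) (h : w * (2 - ε) < W * (1 - ε)) :
    localStay ε W w = rareStay := by
  have f1 : w * (1 - ε) ≤ W * (1 + (1 - ε)) := by nlinarith
  have f2 : W * ε < w * (1 - ε) := by linarith
  have f3 : w * ε ≤ W * (1 + (1 - ε)) := by nlinarith
  have f4 : w * ε ≤ W * ε := by nlinarith
  have f5 : w * ε < W * ε := by nlinarith
  have f6 : w * ε < W * (1 - ε) := by nlinarith
  have f7 : W * ε ≤ w * (1 + (1 - ε)) := by nlinarith
  have f8 : w * (1 + (1 - ε)) < W * (1 - ε) := by linarith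
  funext p b d
  cases p <;> cases b <;> cases d <;>
    simp [localStay, rareStay, predictOn_true, predictOn_false, isOn] <;> assumption

lemma localStay_eq_oftenStay {ε W w : ℝ} (h₀ : 0 < ε) (hw : 0 ≤ w) (hlt : w < W)
    (hle : ε * W < w * (1 - ε)) (h : W * (1 - ε) ≤ w * (2 - ε)) :
    localStay ε W w = oftenStay := by
  have f1 : w * (1 - ε) ≤ W * (1 + (1 - ε)) := by nlinarith
  have f2 : W * ε < w * (1 - ε) := by linarith
  have f3 : w * ε ≤ W * (1 + (1 - ε)) := by nlinarith
  have f4 : w * ε ≤ W * ε := by nlinarith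
  have f5 : w * ε < W * ε := by nlinarith
  have f6 : w * ε < W * (1 - ε) := by nlinarith
  have f7 : W * ε ≤ w * (1 + (1 - ε)) := by nlinarith
  have f8 : W * (1 - ε) ≤ w * (1 + (1 - ε)) := by linarith
  funext p b d
  cases p <;> cases b <;> cases d <;>
    simp [localStay, oftenStay, predictOn_true, predictOn_false, isOn] <;> assumption

/-- The value of the weights `W ≥ w` on the rate region. -/
lemma mul_weighted_rate_le {ε W w : ℝ} (h₁ : ε ≤ 1 / 2) (hlt : w < W)
    (hle : ε * W < w * (1 - ε)) {r s : ℝ} (h1 : r + ε / (1 - ε) * s ≤ 1 / 2)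
    (h2 : r + s ≤ 3 / 4 - ε / 2) :
    (1 - 2 * ε) * (W * r + w * s) ≤
      (W - w) * (1 - ε) / 2 + (w * (1 - ε) - ε * W) * (3 / 4 - ε / 2) := by
  have h3 : 0 < 1 - ε := by linarith
  have h4 : (1 - ε) * r + ε * s ≤ (1 - ε) / 2 := by
    have := mul_le_mul_of_nonneg_left h1 h3.le
    rw [mul_add, ← mul_assoc, mul_div_cancel₀ _ h3.ne'] at this
    linarith
  nlinarith [mul_le_mul_of_nonneg_left h4 (sub_pos.2 hlt).le,
    mul_le_mul_of_nonneg_left h2 (sub_pos.2 hle).le]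

/-- Both sides are linear in the weights, so it suffices to compare them on the extreme rays of the
cone of admissible (W, w). The numbers `α` and `β` are coordinates along these rays, up to the
determinant 1 - 4ε + 2ε², and the difference has nonnegative coefficients in them. -/
lemma gain_rare_ge {ε W w : ℝ} (h₀ : 0 < ε) (h₁ : ε ≤ 1 / 2) (hw : 0 ≤ w) (hlt : w < W)
    (hle : ε * W < w * (1 - ε)) (h : w * (2 - ε) < W * (1 - ε)) {r s : ℝ}
    (h1 : r + ε / (1 - ε) * s ≤ 1 / 2) (h2 : r + s ≤ 3 / 4 - ε / 2) :
    9 / 10 * (W * r + w * s) ≤ W * (1 / 2 - ε / 4) + w * ((1 - ε) ^ 2 / 4) := by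
  have h3 := mul_weighted_rate_le h₁ hlt hle h1 h2
  have hW : 0 < W := hw.trans_lt hlt
  have h4 : 0 < 1 - 2 * ε := by
    by_contra! hc
    nlinarith
  set α := w * (1 - ε) - ε * W with hα
  set β := W * (1 - ε) - w * (2 - ε) with hβ
  have hα0 : 0 < α := sub_pos.2 hle
  have hβ0 : 0 < β := sub_pos.2 h
  have eW : W * (1 - 4 * ε + 2 * ε ^ 2) = α * (2 - ε) + β * (1 - ε) := by rw [hα, hβ]; ring
  have ew : w * (1 - 4 * ε + 2 * ε ^ 2) = α * (1 - ε) + β * ε := by rw [hα, hβ]; ring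
  -- The cone is nonempty only for a positive determinant, which with ε ≤ 1/2 means ε < 1 - 1/√2 <
  -- 3/10.
  have hD : 0 < 1 - 4 * ε + 2 * ε ^ 2 := by
    by_contra! hc
    have : 0 < α * (2 - ε) + β * (1 - ε) := by
      have := mul_pos hα0 (by linarith : 0 < 2 - ε)
      have := mul_pos hβ0 (by linarith : 0 < 1 - ε)
      linarith
    nlinarith
  have hε : ε < 3 / 10 := by nlinarith
  -- The quartic exceeds 15/4 (ε - 26/75)² + 27/5 ε² (3/10 - ε) + 2ε⁴.
  have k1 : 0 ≤ α * (1 / 2 - 26 / 10 * ε + 54 / 10 * ε ^ 2 - 54 / 10 * ε ^ 3 + 2 * ε ^ 4) := by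
    refine mul_nonneg hα0.le ?_
    nlinarith [sq_nonneg (ε - 26 / 75), mul_nonneg (sq_nonneg ε) (by linarith : 0 ≤ 3 / 10 - ε),
      sq_nonneg (ε ^ 2)]
  have k2 : 0 ≤ β * ((1 - 2 * ε) * (1 - ε) * (1 / 20 - ε ^ 2 / 4)) := by
    refine mul_nonneg hβ0.le (mul_nonneg (mul_nonneg h4.le (by linarith)) ?_)
    nlinarith
  refine le_of_mul_le_mul_left ?_ (mul_pos h4 hD)
  have k3 := mul_le_mul_of_nonneg_left h3 hD.le
  have k4 : (1 - 4 * ε + 2 * ε ^ 2) * ((1 - 2 * ε) * (W * (1 / 2 - ε / 4) + w * ((1 - ε) ^ 2 / 4)))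
      - 9 / 10 * ((1 - 4 * ε + 2 * ε ^ 2) *
        ((W - w) * (1 - ε) / 2 + (w * (1 - ε) - ε * W) * (3 / 4 - ε / 2))) =
      α * (1 / 2 - 26 / 10 * ε + 54 / 10 * ε ^ 2 - 54 / 10 * ε ^ 3 + 2 * ε ^ 4) / 4 +
      β * ((1 - 2 * ε) * (1 - ε) * (1 / 20 - ε ^ 2 / 4)) := by
    rw [hα, hβ]; ring
  rw [← hα] at k4
  nlinarith

/-- Again a comparison on two extreme rays. For w = W the policy is optimal and a tenth is spare. On
the ray W(1-ε) = w(2-ε) the slack is of order ε: as ε → 0 the ratio of the policy's value to the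
upper bound tends to 9/10 there, which is where the constant comes from. -/
lemma gain_often_ge {ε W w : ℝ} (h₀ : 0 < ε) (h₁ : ε ≤ 1 / 2) (hw : 0 ≤ w) (hlt : w < W)
    (hle : ε * W < w * (1 - ε)) (h : W * (1 - ε) ≤ w * (2 - ε)) {r s : ℝ}
    (h1 : r + ε / (1 - ε) * s ≤ 1 / 2) (h2 : r + s ≤ 3 / 4 - ε / 2) :
    9 / 10 * (W * r + w * s) ≤
      W * ((3 / 4 - ε / 2) / (2 - ε)) + w * ((3 / 4 - ε / 2) * (1 - ε) / (2 - ε)) := by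
  have h3 := mul_weighted_rate_le h₁ hlt hle h1 h2
  have hW : 0 < W := hw.trans_lt hlt
  have h4 : 0 < 1 - 2 * ε := by
    by_contra! hc
    nlinarith
  have h5 : 0 < 2 - ε := by linarith
  have k1 : 0 ≤ (W - w) * (ε / 40 * (1 - 2 * ε) * (3 - 2 * ε ^ 2)) := by
    refine mul_nonneg (sub_pos.2 hlt).le (mul_nonneg (mul_nonneg (by linarith) h4.le) ?_)
    nlinarith
  have k2 : 0 ≤ (w * (2 - ε) - W * (1 - ε)) *
      (1 / 10 * (1 - 2 * ε) * (3 / 4 - ε / 2) * (2 - ε)) :=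
    mul_nonneg (sub_nonneg.2 h) (mul_nonneg (mul_nonneg (by linarith) (by linarith)) h5.le)
  refine le_of_mul_le_mul_left ?_ (mul_pos h4 h5)
  have k3 := mul_le_mul_of_nonneg_left h3 h5.le
  have k4 : (1 - 2 * ε) * (2 - ε) *
      (W * ((3 / 4 - ε / 2) / (2 - ε)) + w * ((3 / 4 - ε / 2) * (1 - ε) / (2 - ε))) =
      (1 - 2 * ε) * (3 / 4 - ε / 2) * (W + w * (1 - ε)) := by
    field_simp
  rw [k4]
  linarith

/-- Myopic actions have large drift: for each `ε` there are potentials, of size at most `c (W + w)`,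
whose drift is at least nine tenths of the weighted rate of any pair in the rate region. -/
lemma exists_potential_of_le {ε : ℝ} (h₀ : 0 < ε) (h₁ : ε ≤ 1 / 2) :
    ∃ c > 0, ∀ W w : ℝ, 0 ≤ w → w ≤ W → ∃ φ : Bool → Bool → Bool → ℝ,
      (∀ p b d, |φ p b d| ≤ c * (W + w)) ∧
      ∀ r s : ℝ, 0 ≤ s → r + ε / (1 - ε) * s ≤ 1 / 2 → r + s ≤ 3 / 4 - ε / 2 → ∀ p b d,
        9 / 10 * (W * r + w * s) ≤ drift ε W w φ p b d (localStay ε W w p b d) := by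
  have hb : ∀ ψ : Bool → Bool → Bool → ℝ, ∃ C, 0 ≤ C ∧ ∀ p b d, |ψ p b d| ≤ C := by
    intro ψ
    refine ⟨∑ x : Bool × Bool × Bool, |ψ x.1 x.2.1 x.2.2|,
      Finset.sum_nonneg fun _ _ => abs_nonneg _, fun p b d => ?_⟩
    exact Finset.single_le_sum (f := fun x : Bool × Bool × Bool => |ψ x.1 x.2.1 x.2.2|)
      (fun _ _ => abs_nonneg _) (Finset.mem_univ (p, b, d))
  obtain ⟨C₁, hC₁, B₁⟩ := hb (phiSum ε)
  obtain ⟨C₂, hC₂, B₂⟩ := hb (psiStay ε)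
  obtain ⟨C₃, hC₃, B₃⟩ := hb (psiRareLong ε)
  obtain ⟨C₄, hC₄, B₄⟩ := hb (psiRareShort ε)
  obtain ⟨C₅, hC₅, B₅⟩ := hb (psiOftenLong ε)
  obtain ⟨C₆, hC₆, B₆⟩ := hb (psiOftenShort ε)
  set c := C₁ + C₂ + C₃ + C₄ + C₅ + C₆ + 1 with hc
  have hsum : ∀ {W w : ℝ} {ψ₁ ψ₂ : Bool → Bool → Bool → ℝ} {K₁ K₂ : ℝ}, 0 ≤ w → w ≤ W →
      (∀ p b d, |ψ₁ p b d| ≤ K₁) → (∀ p b d, |ψ₂ p b d| ≤ K₂) → K₁ ≤ c → K₂ ≤ c → ∀ p b d,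
      |W * ψ₁ p b d + w * ψ₂ p b d| ≤ c * (W + w) := by
    intro W w ψ₁ ψ₂ K₁ K₂ hw hW H₁ H₂ h1 h2 p b d
    refine (abs_add_le _ _).trans ?_
    rw [abs_mul, abs_mul, abs_of_nonneg hw, abs_of_nonneg (hw.trans hW)]
    nlinarith [mul_le_mul_of_nonneg_left ((H₁ p b d).trans h1) (hw.trans hW),
      mul_le_mul_of_nonneg_left ((H₂ p b d).trans h2) hw]
  have hone : ∀ {W w : ℝ} {ψ : Bool → Bool → Bool → ℝ} {K : ℝ}, 0 ≤ w → w ≤ W →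
      (∀ p b d, |ψ p b d| ≤ K) → K ≤ c → ∀ p b d, |W * ψ p b d| ≤ c * (W + w) := by
    intro W w ψ K hw hW H h1 p b d
    simpa using hsum (ψ₂ := fun _ _ _ => 0) (K₂ := 0) hw hW H (by simp) h1 (by linarith) p b d
  refine ⟨c, by linarith, fun W w hw hW => ?_⟩
  rcases hW.eq_or_lt with rfl | hlt
  · refine ⟨fun p b d => w * phiSum ε p b d, hone hw le_rfl B₁ (by linarith),
      fun r s hs h1 h2 p b d => le_trans ?_ (drift_phiSum_localStay h₀ h₁ hw p b d)⟩
    nlinarith [mul_le_mul_of_nonneg_left h2 hw]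
  rcases le_or_gt (w * (1 - ε)) (ε * W) with hle | hle
  · refine ⟨fun p b d => W * psiStay ε p b d, hone hw hW B₂ (by linarith),
      fun r s hs h1 h2 p b d => le_trans ?_ (drift_psiStay_localStay h₀ h₁ hw hlt hle p b d)⟩
    -- As s ≥ 0, this gives W r + w s ≤ W (r + ε/(1-ε) s) ≤ W/2: the policy loses nothing here.
    have h3 : w ≤ ε / (1 - ε) * W := by
      rw [div_mul_eq_mul_div, le_div_iff₀ (by linarith)]; exact hle
    nlinarith [mul_le_mul_of_nonneg_right h3 hs, mul_le_mul_of_nonneg_left h1 (hw.trans hW)]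
  rcases lt_or_ge (w * (2 - ε)) (W * (1 - ε)) with h | h
  · refine ⟨fun p b d => W * psiRareLong ε p b d + w * psiRareShort ε p b d,
      hsum hw hW B₃ B₄ (by linarith) (by linarith), fun r s hs h1 h2 p b d => ?_⟩
    rw [localStay_eq_rareStay h₀ hw hlt hle h, drift_add,
      drift_psiRareLong h₀ (by linarith), drift_psiRareShort h₀ (by linarith)]
    exact gain_rare_ge h₀ h₁ hw hlt hle h h1 h2
  · refine ⟨fun p b d => W * psiOftenLong ε p b d + w * psiOftenShort ε p b d,
      hsum hw hW B₅ B₆ (by linarith) (by linarith), fun r s hs h1 h2 p b d => ?_⟩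
    rw [localStay_eq_oftenStay h₀ hw hlt hle h, drift_add,
      drift_psiOftenLong h₀ (by linarith), drift_psiOftenShort h₀ (by linarith)]
    exact gain_often_ge h₀ h₁ hw hlt hle h h1 h2

/-- The same for the queue lengths `w`. -/
lemma exists_potential {ε : ℝ} (h₀ : 0 < ε) (h₁ : ε ≤ 1 / 2) :
    ∃ c > 0, ∀ w : Fin 2 → ℕ, ∃ h : State → ℝ,
      (∀ s, |h s| ≤ c * ∑ i, (w i : ℝ)) ∧ ∀ r ∈ rateRegion ε, ∀ s : State,
        9 / 10 * ∑ i, (w i : ℝ) * r i ≤ ∑ i, (w i : ℝ) * reward i s (myopicStay ε w s.1 s.2) +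
          ∑ s', stateProb ε s (myopicStay ε w s.1 s.2) s' * h s' - h s := by
  obtain ⟨c, hc, H⟩ := exists_potential_of_le h₀ h₁
  refine ⟨c, hc, fun w => ?_⟩
  obtain ⟨x, hx⟩ : ∃ x : Fin 2, w (x + 1) ≤ w x := by
    rcases le_total (w 0) (w 1) with h | h
    · exact ⟨1, h⟩
    · exact ⟨0, h⟩
  have hsum : ∀ f : Fin 2 → ℝ, ∑ i, f i = f x + f (x + 1) := by
    intro f; fin_cases x <;> simp [Fin.sum_univ_two, add_comm]
  obtain ⟨φ, hφ, hd⟩ := H (w x) (w (x + 1)) (by positivity) (by exact_mod_cast hx)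
  refine ⟨potential x φ, fun s => ?_, fun r hr s => ?_⟩
  · rw [hsum]; exact hφ _ _ _
  · rw [drift_eq ε (fun i => (w i : ℝ)) x, myopicStay_eq ε w x, hsum]
    have key : ∀ (v : Fin 2 → ℝ) (g : ℝ) (ψ : Bool → Bool → Bool → ℝ),
        (∀ p b d a, drift ε (v x) (v (x + 1)) ψ p b d a ≤ g) →
        v x * r x + v (x + 1) * r (x + 1) ≤ g := by
      intro v g ψ hψ
      have := rateRegion_le h₀ h₁ (v := v) (g := g) (h := potential x ψ)
        (fun s a => by rw [drift_eq]; exact hψ _ _ _ _) hr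
      rwa [hsum] at this
    have hne : x + 1 ≠ x := by fin_cases x <;> decide
    refine hd (r x) (r (x + 1)) ?_ ?_ ?_ _ _ _
    -- Nonnegativity of the rate of the shorter queue: weight -1 on it and the zero potential.
    · have := key (fun i => if i = x then 0 else -1) 0 (fun _ _ _ => 0) ?_
      · simp [hne] at this; exact this
      · intro p b d a
        cases p <;> cases d <;> cases a <;> simp [drift, hne, isOn]
    · have := key (fun i => if i = x then 1 else ε / (1 - ε)) (1 / 2) (phiOne ε) ?_
      · simpa [hne] using this
      · intro p b d a
        simpa [hne] using drift_phiOne_le h₀ h₁ p b d a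
    · have := key (fun i => 1) (3 / 4 - ε / 2) (phiSum ε) (drift_phiSum_le h₀ h₁)
      simpa using this

/-! ### Sample paths of the myopic policy -/

/-- The state (server position and channels) at the beginning of slot `t`. -/
def slotState (ε : ℝ) (T : ℕ) (m₀ : Fin 2) (q₀ : Fin 2 → ℕ) (a : ℕ → Fin 2 → ℕ)
    (c : ℕ → Fin 2 → Bool) (t : ℕ) : State := ((myopicRun ε T m₀ q₀ a c t).1, c t)

/-- The action in a slot in state `s` when the queue lengths at the beginning of the frame
are `w`. -/
abbrev stayAt (ε : ℝ) (w : Fin 2 → ℕ) (s : State) : Bool := myopicStay ε w s.1 s.2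

section Paths

variable (ε : ℝ) (T : ℕ) (m₀ : Fin 2) (q₀ : Fin 2 → ℕ) (a : ℕ → Fin 2 → ℕ) (c : ℕ → Fin 2 → Bool)

lemma myopicRun_zero : myopicRun ε T m₀ q₀ a c 0 = (m₀, q₀) := by rw [myopicRun]

lemma myopicRun_succ (t : ℕ) : myopicRun ε T m₀ q₀ a c (t + 1) =
    (nextServer (myopicRun ε T m₀ q₀ a c t).1
      (stayAt ε (myopicRun ε T m₀ q₀ a c (T * (t / T))).2 (slotState ε T m₀ q₀ a c t)),
     fun i => (myopicRun ε T m₀ q₀ a c t).2 i + a t i -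
      departure i (myopicRun ε T m₀ q₀ a c t).1
        (stayAt ε (myopicRun ε T m₀ q₀ a c (T * (t / T))).2 (slotState ε T m₀ q₀ a c t))
        (c t) (myopicRun ε T m₀ q₀ a c t).2) := by
  rw [myopicRun]; rfl

/-- Causality: position and queues at the beginning of slot `t` depend only on strictly earlier
inputs. The induction is strong because an action refers back to the start of its frame. -/
lemma myopicRun_congr {a' : ℕ → Fin 2 → ℕ} {c' : ℕ → Fin 2 → Bool} (t : ℕ)
    (ha : ∀ s < t, a s = a' s) (hc : ∀ s < t, c s = c' s) :
    myopicRun ε T m₀ q₀ a c t = myopicRun ε T m₀ q₀ a' c' t := by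
  induction t using Nat.strong_induction_on with
  | _ t ih =>
    cases t with
    | zero => simp only [myopicRun_zero]
    | succ t =>
      have hle : T * (t / T) < t + 1 := Nat.lt_succ_of_le (Nat.mul_div_le t T)
      have h1 := ih t t.lt_succ_self (fun s hs => ha s (by omega)) (fun s hs => hc s (by omega))
      have h2 := ih _ hle (fun s hs => ha s (by omega)) (fun s hs => hc s (by omega))
      simp only [myopicRun_succ, slotState, h1, h2, ha t t.lt_succ_self, hc t t.lt_succ_self]

lemma queue_le (t : ℕ) (i : Fin 2) :
    (myopicRun ε T m₀ q₀ a c t).2 i ≤ q₀ i + ∑ s ∈ Finset.range t, a s i := by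
  induction t with
  | zero => simp [myopicRun_zero]
  | succ t ih =>
    rw [myopicRun_succ, Finset.sum_range_succ]
    dsimp only
    omega

/-- Queue lengths, together with the departures, over consecutive slots. -/
lemma queue_le_add (t k : ℕ) (i : Fin 2) : (myopicRun ε T m₀ q₀ a c (t + k)).2 i ≤
    (myopicRun ε T m₀ q₀ a c t).2 i + ∑ s ∈ Finset.range k, a (t + s) i := by
  induction k with
  | zero => simp
  | succ k ih =>
    rw [← add_assoc, myopicRun_succ, Finset.sum_range_succ]
    dsimp only
    omega

lemma departure_le_one (i m : Fin 2) (stay : Bool) (c : Fin 2 → Bool) (q : Fin 2 → ℕ) :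
    departure i m stay c q ≤ 1 := by
  unfold departure; split_ifs <;> simp

lemma departure_le (i m : Fin 2) (stay : Bool) (c : Fin 2 → Bool) (q : Fin 2 → ℕ) :
    departure i m stay c q ≤ q i := by
  unfold departure; split_ifs <;> omega

/-- The departure from queue `i` in slot `t`. -/
def departs (i : Fin 2) (t : ℕ) : ℕ :=
  departure i (myopicRun ε T m₀ q₀ a c t).1
    (stayAt ε (myopicRun ε T m₀ q₀ a c (T * (t / T))).2 (slotState ε T m₀ q₀ a c t))
    (c t) (myopicRun ε T m₀ q₀ a c t).2

lemma queue_add (t k : ℕ) (i : Fin 2) : (myopicRun ε T m₀ q₀ a c (t + k)).2 i +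
      ∑ s ∈ Finset.range k, departs ε T m₀ q₀ a c i (t + s) =
    (myopicRun ε T m₀ q₀ a c t).2 i + ∑ s ∈ Finset.range k, a (t + s) i := by
  induction k with
  | zero => simp
  | succ k ih =>
    rw [← add_assoc, myopicRun_succ, Finset.sum_range_succ, Finset.sum_range_succ]
    dsimp only
    -- The truncated subtraction in the recursion is a true one.
    have := departure_le i (myopicRun ε T m₀ q₀ a c (t + k)).1
      (stayAt ε (myopicRun ε T m₀ q₀ a c (T * ((t + k) / T))).2
        (slotState ε T m₀ q₀ a c (t + k))) (c (t + k)) (myopicRun ε T m₀ q₀ a c (t + k)).2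
    change departs ε T m₀ q₀ a c i (t + k) ≤ _ at this
    change _ + _ - departs ε T m₀ q₀ a c i (t + k) + _ = _
    omega

lemma frame_start {T : ℕ} {k : ℕ} (hk : k < T) (j : ℕ) : T * ((T * j + k) / T) = T * j := by
  rw [Nat.mul_add_div (by omega), Nat.div_eq_of_lt hk, add_zero]

/-- In a frame, the weighted departures differ little from those of the saturated system. -/
lemma mul_reward_le (j : ℕ) {k : ℕ} (hk : k < T) (i : Fin 2) :
    ((myopicRun ε T m₀ q₀ a c (T * j)).2 i : ℝ) * reward i (slotState ε T m₀ q₀ a c (T * j + k))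
        (stayAt ε (myopicRun ε T m₀ q₀ a c (T * j)).2 (slotState ε T m₀ q₀ a c (T * j + k))) ≤
      (myopicRun ε T m₀ q₀ a c (T * j)).2 i * departs ε T m₀ q₀ a c i (T * j + k) + T := by
  rw [departs, frame_start hk]
  set w := (myopicRun ε T m₀ q₀ a c (T * j)).2 with hw
  by_cases h : 0 < (myopicRun ε T m₀ q₀ a c (T * j + k)).2 i
  · have : (departure i (myopicRun ε T m₀ q₀ a c (T * j + k)).1
        (stayAt ε w (slotState ε T m₀ q₀ a c (T * j + k))) (c (T * j + k))
        (myopicRun ε T m₀ q₀ a c (T * j + k)).2 : ℝ) =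
        reward i (slotState ε T m₀ q₀ a c (T * j + k))
          (stayAt ε w (slotState ε T m₀ q₀ a c (T * j + k))) := by
      simp only [departure, reward, slotState, h, and_true, Nat.cast_ite, Nat.cast_one,
        Nat.cast_zero]
      congr
    rw [this]
    linarith [(Nat.cast_nonneg T : (0 : ℝ) ≤ T)]
  -- At most one packet leaves per slot, so a queue empty after `k` slots of the frame had length at
  -- most k ≤ T at its start; the fictitious reward is then worth at most T.
  · have h1 := queue_add ε T m₀ q₀ a c (T * j) k i
    have h2 : ∑ s ∈ Finset.range k, departs ε T m₀ q₀ a c i (T * j + s) ≤ k := by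
      refine (Finset.sum_le_card_nsmul _ _ 1 fun s _ => departure_le_one _ _ _ _ _).trans ?_
      simp
    have h3 : w i ≤ T := by rw [hw]; omega
    have h4 : (w i : ℝ) ≤ T := by exact_mod_cast h3
    have h5 : reward i (slotState ε T m₀ q₀ a c (T * j + k))
        (stayAt ε w (slotState ε T m₀ q₀ a c (T * j + k))) ≤ 1 := by
      unfold reward; split_ifs <;> norm_num
    have h6 : (0 : ℝ) ≤ w i := Nat.cast_nonneg _
    refine le_add_of_nonneg_of_le (by positivity) ?_
    nlinarith

/-- The increase of the square of a queue length over a frame. -/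
lemma sq_queue_le (j : ℕ) (i : Fin 2) :
    ((myopicRun ε T m₀ q₀ a c (T * (j + 1))).2 i : ℝ) ^ 2 ≤
      ((myopicRun ε T m₀ q₀ a c (T * j)).2 i : ℝ) ^ 2 +
      2 * ∑ k ∈ Finset.range T, ((myopicRun ε T m₀ q₀ a c (T * j)).2 i : ℝ) * a (T * j + k) i -
      2 * ∑ k ∈ Finset.range T, ((myopicRun ε T m₀ q₀ a c (T * j)).2 i : ℝ) *
        reward i (slotState ε T m₀ q₀ a c (T * j + k))
          (stayAt ε (myopicRun ε T m₀ q₀ a c (T * j)).2 (slotState ε T m₀ q₀ a c (T * j + k))) +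
      T * ∑ k ∈ Finset.range T, (a (T * j + k) i : ℝ) ^ 2 + 3 * (T : ℝ) ^ 2 := by
  have h1 := queue_add ε T m₀ q₀ a c (T * j) T i
  have h2 : ∑ s ∈ Finset.range T, departs ε T m₀ q₀ a c i (T * j + s) ≤ T := by
    refine (Finset.sum_le_card_nsmul _ _ 1 fun s _ => departure_le_one _ _ _ _ _).trans ?_
    simp
  have h3 : ∑ k ∈ Finset.range T, ((myopicRun ε T m₀ q₀ a c (T * j)).2 i : ℝ) *
        reward i (slotState ε T m₀ q₀ a c (T * j + k))
          (stayAt ε (myopicRun ε T m₀ q₀ a c (T * j)).2 (slotState ε T m₀ q₀ a c (T * j + k))) ≤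
      (myopicRun ε T m₀ q₀ a c (T * j)).2 i *
        ∑ k ∈ Finset.range T, (departs ε T m₀ q₀ a c i (T * j + k) : ℝ) + (T : ℝ) ^ 2 := by
    refine (Finset.sum_le_sum fun k hk => mul_reward_le ε T m₀ q₀ a c j
      (Finset.mem_range.1 hk) i).trans ?_
    rw [Finset.sum_add_distrib, Finset.mul_sum]
    simp [sq]
  have h4 : (∑ k ∈ Finset.range T, (a (T * j + k) i : ℝ)) ^ 2 ≤
      T * ∑ k ∈ Finset.range T, (a (T * j + k) i : ℝ) ^ 2 := by
    simpa using sq_sum_le_card_mul_sum_sq (s := Finset.range T)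
      (f := fun k => (a (T * j + k) i : ℝ))
  rw [← Finset.mul_sum, mul_add, mul_one]
  have h1' : ((myopicRun ε T m₀ q₀ a c (T * j + T)).2 i : ℝ) =
      (myopicRun ε T m₀ q₀ a c (T * j)).2 i + ∑ s ∈ Finset.range T, (a (T * j + s) i : ℝ) -
        ∑ s ∈ Finset.range T, (departs ε T m₀ q₀ a c i (T * j + s) : ℝ) := by
    rw [eq_sub_iff_add_eq]; exact_mod_cast h1
  have h2' : ∑ s ∈ Finset.range T, (departs ε T m₀ q₀ a c i (T * j + s) : ℝ) ≤ T := by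
    exact_mod_cast h2
  have h5 : 0 ≤ ∑ s ∈ Finset.range T, (departs ε T m₀ q₀ a c i (T * j + s) : ℝ) := by positivity
  have h6 : 0 ≤ ∑ s ∈ Finset.range T, (a (T * j + s) i : ℝ) := by positivity
  rw [h1']
  -- With A arrivals and D ≤ T departures, (A - D)² ≤ A² + D². The term D² gives one T², and the
  -- correction for empty queues, doubled, gives the other two.
  nlinarith

end Paths

/-- Only inputs before `t` are assumed measurable, so that the lemma also applies to the σ-algebra
of the past arrivals. -/
lemma measurable_myopicRun {Ω : Type*} [MeasurableSpace Ω] (ε : ℝ) (T : ℕ) (m₀ : Fin 2)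
    (q₀ : Fin 2 → ℕ) {a : ℕ → Fin 2 → Ω → ℕ} {c : ℕ → Fin 2 → Ω → Bool} (t : ℕ)
    (ha : ∀ s < t, ∀ i, Measurable (a s i)) (hc : ∀ s < t, ∀ i, Measurable (c s i)) :
    Measurable fun ω => myopicRun ε T m₀ q₀ (fun s i => a s i ω) (fun s i => c s i ω) t := by
  induction t using Nat.strong_induction_on with
  | _ t ih =>
    cases t with
    | zero => simp only [myopicRun_zero]; exact measurable_const
    | succ t =>
      have hle : T * (t / T) < t + 1 := Nat.lt_succ_of_le (Nat.mul_div_le t T)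
      have h1 := ih t t.lt_succ_self (fun s hs => ha s (by omega)) (fun s hs => hc s (by omega))
      have h2 := ih _ hle (fun s hs => ha s (by omega)) (fun s hs => hc s (by omega))
      have h3 : Measurable fun ω => fun i => a t i ω := measurable_pi_lambda _ (ha t t.lt_succ_self)
      have h4 : Measurable fun ω => fun i => c t i ω := measurable_pi_lambda _ (hc t t.lt_succ_self)
      let Φ : ((Fin 2 × (Fin 2 → ℕ)) × (Fin 2 × (Fin 2 → ℕ))) × (Fin 2 → ℕ) × (Fin 2 → Bool) →
          Fin 2 × (Fin 2 → ℕ) := fun x =>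
        (nextServer x.1.1.1 (stayAt ε x.1.2.2 (x.1.1.1, x.2.2)), fun i => x.1.1.2 i + x.2.1 i -
          departure i x.1.1.1 (stayAt ε x.1.2.2 (x.1.1.1, x.2.2)) x.2.2 x.1.1.2)
      have hΦ : Measurable Φ := measurable_of_countable _
      have := hΦ.comp ((h1.prodMk h2).prodMk (h3.prodMk h4))
      simp only [myopicRun_succ]
      exact this

/-! ### The channels -/

section Channel

variable {Ω : Type*}

/-- The arrivals, slot by slot. -/
def arrivalPath (A : Fin 2 → ℕ → Ω → ℕ) (ω : Ω) : ℕ → Fin 2 → ℕ := fun t i => A i t ω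

/-- The channel states, slot by slot. -/
def channelPath (C : Fin 2 → ℕ → Ω → Bool) (ω : Ω) : ℕ → Fin 2 → Bool := fun t i => C i t ω

/-- The event that the channels follow the path `c` up to slot `t`. -/
def cylinder (C : Fin 2 → ℕ → Ω → Bool) (t : ℕ) (c : ℕ → Fin 2 → Bool) : Set Ω :=
  {ω | ∀ s ≤ t, channelPath C ω s = c s}

/-- The path that a finite sequence of channel states begins. -/
def extendPath {t : ℕ} (p : Fin (t + 1) → Fin 2 → Bool) (s : ℕ) : Fin 2 → Bool :=
  if h : s < t + 1 then p ⟨s, h⟩ else fun _ => false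

lemma extendPath_apply {t : ℕ} (p : Fin (t + 1) → Fin 2 → Bool) {s : ℕ} (h : s ≤ t) :
    extendPath p s = p ⟨s, Nat.lt_succ_of_le h⟩ := dif_pos _

variable {A : Fin 2 → ℕ → Ω → ℕ} {C : Fin 2 → ℕ → Ω → Bool}

/-- The four σ-algebras of the input processes. -/
abbrev inputAlgebra (A : Fin 2 → ℕ → Ω → ℕ) (C : Fin 2 → ℕ → Ω → Bool) :
    Fin 2 ⊕ Fin 2 → MeasurableSpace Ω :=
  Sum.elim (fun i : Fin 2 => MeasurableSpace.comap (fun (ω : Ω) (t : ℕ) => A i t ω) inferInstance)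
    (fun i : Fin 2 => MeasurableSpace.comap (fun (ω : Ω) (t : ℕ) => C i t ω) inferInstance)

lemma measurable_arrival (i : Fin 2) (t : ℕ) {m : MeasurableSpace Ω}
    (hm : inputAlgebra A C (Sum.inl i) ≤ m) : Measurable[m] (A i t) :=
  (((measurable_pi_apply t).comp (comap_measurable (fun (ω : Ω) (t : ℕ) => A i t ω))).mono hm
    le_rfl :)

lemma measurable_channel (i : Fin 2) (t : ℕ) {m : MeasurableSpace Ω}
    (hm : inputAlgebra A C (Sum.inr i) ≤ m) : Measurable[m] (C i t) :=
  (((measurable_pi_apply t).comp (comap_measurable (fun (ω : Ω) (t : ℕ) => C i t ω))).mono hm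
    le_rfl :)

lemma measurable_arrivalPath_of_le {m : MeasurableSpace Ω}
    (hm : ∀ i, inputAlgebra A C (Sum.inl i) ≤ m) : Measurable[m] (arrivalPath A) :=
  measurable_pi_lambda _ fun t => measurable_pi_lambda _ fun i => measurable_arrival i t (hm i)

lemma iUnion_cylinder (t : ℕ) :
    ⋃ p : Fin (t + 1) → Fin 2 → Bool, cylinder C t (extendPath p) = Set.univ := by
  refine Set.eq_univ_of_forall fun ω => Set.mem_iUnion.2 ⟨fun s => channelPath C ω s, ?_⟩
  intro s hs
  rw [extendPath_apply _ hs]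

lemma pairwise_disjoint_cylinder (t : ℕ) : Pairwise (Function.onFun Disjoint
    fun p : Fin (t + 1) → Fin 2 → Bool => cylinder C t (extendPath p)) := by
  intro p p' hne
  refine Set.disjoint_left.2 fun ω h h' => hne (funext fun s => ?_)
  have hs : (s : ℕ) ≤ t := Nat.le_of_lt_succ s.2
  have := (h s hs).symm.trans (h' s hs)
  rwa [extendPath_apply _ hs, extendPath_apply _ hs] at this

/-- The σ-algebra of the channels. -/
abbrev channelAlgebra (A : Fin 2 → ℕ → Ω → ℕ) (C : Fin 2 → ℕ → Ω → Bool) : MeasurableSpace Ω :=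
  ⨆ k ∈ Set.range (Sum.inr : Fin 2 → Fin 2 ⊕ Fin 2), inputAlgebra A C k

lemma measurableSet_cylinder (t : ℕ) (c : ℕ → Fin 2 → Bool) :
    MeasurableSet[channelAlgebra A C] (cylinder C t c) := by
  have : cylinder C t c = ⋂ s, ⋂ (_ : s ≤ t), ⋂ i, C i s ⁻¹' {c s i} := by
    ext ω; simp [cylinder, channelPath, funext_iff]
  rw [this]
  refine MeasurableSet.iInter fun s => MeasurableSet.iInter fun _ => MeasurableSet.iInter fun i => ?_
  exact measurable_channel (A := A) i s
    (le_iSup₂_of_le (Sum.inr i) (Set.mem_range_self i) le_rfl) (measurableSet_singleton _)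

variable [MeasurableSpace Ω] {μ : Measure Ω} {ε : ℝ} {lam : Fin 2 → ℝ}

lemma IsSystemInput.inputAlgebra_le (hin : IsSystemInput μ ε lam A C) (k : Fin 2 ⊕ Fin 2) :
    inputAlgebra A C k ≤ ‹MeasurableSpace Ω› := by
  rcases k with i | i
  · exact (measurable_pi_lambda _ fun t => (hin.arrival i).measurable t).comap_le
  · exact (measurable_pi_lambda _ fun t => (hin.channel i).measurable t).comap_le

lemma IsSystemInput.measurable_arrivalPath (hin : IsSystemInput μ ε lam A C) :
    Measurable (arrivalPath A) :=
  measurable_pi_lambda _ fun t => measurable_pi_lambda _ fun i => (hin.arrival i).measurable t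

lemma IsSystemInput.measurable_channelPath (hin : IsSystemInput μ ε lam A C) :
    Measurable (channelPath C) :=
  measurable_pi_lambda _ fun t => measurable_pi_lambda _ fun i => (hin.channel i).measurable t

lemma IsSystemInput.indep_channelAlgebra (hin : IsSystemInput μ ε lam A C) :
    Indep (channelAlgebra A C) (MeasurableSpace.comap (arrivalPath A) inferInstance) μ := by
  have h := indep_iSup_of_disjoint hin.inputAlgebra_le hin.indep
    (S := Set.range Sum.inr) (T := Set.range Sum.inl) Set.isCompl_range_inl_range_inr.symm.disjoint
  refine indep_of_indep_of_le_right h (Measurable.comap_le ?_)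
  exact measurable_arrivalPath_of_le (C := C) fun i =>
    le_iSup₂_of_le (Sum.inl i) (Set.mem_range_self i) le_rfl

lemma IsSystemInput.channelAlgebra_le (hin : IsSystemInput μ ε lam A C) :
    channelAlgebra A C ≤ ‹MeasurableSpace Ω› := iSup₂_le fun k _ => hin.inputAlgebra_le k

lemma IsSystemInput.real_cylinder (hin : IsSystemInput μ ε lam A C) (t : ℕ)
    (c : ℕ → Fin 2 → Bool) :
    μ.real (cylinder C t c) = ∏ i, μ.real {ω | ∀ s ≤ t, C i s ω = c s i} := by
  have h := iIndep.meas_biInter (S := {Sum.inr 0, Sum.inr 1})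
    (s := Sum.elim (fun _ => Set.univ) (fun i => {ω | ∀ s ≤ t, C i s ω = c s i})) hin.indep ?_
  · have h1 : cylinder C t c = {ω | ∀ s ≤ t, C 0 s ω = c s 0} ∩ {ω | ∀ s ≤ t, C 1 s ω = c s 1} := by
      ext ω
      simp only [cylinder, channelPath, funext_iff, Fin.forall_fin_two, Set.mem_ofPred_eq,
        Set.mem_inter_iff]
      exact ⟨fun h => ⟨fun s hs => (h s hs).1, fun s hs => (h s hs).2⟩,
        fun h s hs => ⟨h.1 s hs, h.2 s hs⟩⟩
    simp only [Finset.set_biInter_insert, Finset.set_biInter_singleton, Sum.elim_inr] at h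
    rw [h1, Measure.real, h, Finset.prod_pair (by simp), ENNReal.toReal_mul, Fin.prod_univ_two]
    rfl
  · intro k hk
    have h2 : ∀ i, MeasurableSet[inputAlgebra A C (Sum.inr i)] {ω | ∀ s ≤ t, C i s ω = c s i} := by
      intro i
      have : {ω | ∀ s ≤ t, C i s ω = c s i} = ⋂ s, ⋂ (_ : s ≤ t), C i s ⁻¹' {c s i} := by
        ext ω; simp
      rw [this]
      refine MeasurableSet.iInter fun s => MeasurableSet.iInter fun _ => ?_
      exact measurable_channel (A := A) i s le_rfl (measurableSet_singleton _)
    rcases k with i | i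
    · simp at hk
    · exact h2 i

/-- By independence the pair of channels is again a Markov chain, with product transition
probabilities. -/
lemma IsSystemInput.real_cylinder_succ (hin : IsSystemInput μ ε lam A C) (t : ℕ)
    (c : ℕ → Fin 2 → Bool) : μ.real (cylinder C (t + 1) c) =
      μ.real (cylinder C t c) * ∏ i, chanProb ε (c t i) (c (t + 1) i) := by
  rw [hin.real_cylinder, hin.real_cylinder, ← Finset.prod_mul_distrib]
  exact Finset.prod_congr rfl fun i _ => (hin.channel i).markov t fun s => c s i

lemma integral_eq_sum_cylinder (hin : IsSystemInput μ ε lam A C) {f : Ω → ℝ} {t : ℕ}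
    (hf : ∀ p : Fin (t + 1) → Fin 2 → Bool, IntegrableOn f (cylinder C t (extendPath p)) μ) :
    Integrable f μ ∧ ∫ ω, f ω ∂μ =
      ∑ p : Fin (t + 1) → Fin 2 → Bool, ∫ ω in cylinder C t (extendPath p), f ω ∂μ := by
  constructor
  · rw [← integrableOn_univ, ← iUnion_cylinder t]
    exact integrableOn_finite_iUnion.2 hf
  · rw [← setIntegral_univ, ← iUnion_cylinder t]
    exact integral_iUnion_fintype
      (fun p => hin.channelAlgebra_le _ (measurableSet_cylinder (A := A) t _))
      (pairwise_disjoint_cylinder t) hf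

/-- The Markov property of the channels, given the arrivals. -/
lemma IsSystemInput.integral_channel_step [IsProbabilityMeasure μ]
    (hin : IsSystemInput μ ε lam A C) (t : ℕ)
    {F : (ℕ → Fin 2 → ℕ) → (ℕ → Fin 2 → Bool) → ℝ} (hF : ∀ c, Measurable fun a => F a c)
    (hcongr : ∀ a c c', (∀ s ≤ t, c s = c' s) → F a c = F a c')
    (hint : ∀ c, Integrable (fun ω => F (arrivalPath A ω) c) μ) (c' : Fin 2 → Bool) :
    ∫ ω, F (arrivalPath A ω) (channelPath C ω) * (if channelPath C ω (t + 1) = c' then 1 else 0) ∂μ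
      = ∫ ω, F (arrivalPath A ω) (channelPath C ω) *
        ∏ i, chanProb ε (channelPath C ω t i) (c' i) ∂μ := by
  have hms : ∀ s c, MeasurableSet (cylinder C s c) := fun s c =>
    hin.channelAlgebra_le _ (measurableSet_cylinder (A := A) s c)
  -- With the channel path frozen, `F` is a function of the arrivals alone, hence independent of the
  -- channel event.
  have hmul : ∀ s c c₂, ∫ ω in cylinder C s c₂, F (arrivalPath A ω) c ∂μ =
      μ.real (cylinder C s c₂) * ∫ ω, F (arrivalPath A ω) c ∂μ := by
    intro s c c₂
    exact hin.indep_channelAlgebra.setIntegral_eq_mul hin.channelAlgebra_le (f := fun a => F a c)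
      hin.measurable_arrivalPath.aemeasurable (measurableSet_cylinder s c₂)
      (hF c).aestronglyMeasurable
  -- the path `c` followed by `c'`
  let ext : (ℕ → Fin 2 → Bool) → ℕ → Fin 2 → Bool := fun c => Function.update c (t + 1) c'
  have hx1 : ∀ c s, s ≤ t → ext c s = c s := fun c s hs => Function.update_of_ne (by omega) _ _
  have hx2 : ∀ c, ext c (t + 1) = c' := fun c => Function.update_self _ _ _
  have hext : ∀ c, cylinder C (t + 1) (ext c) =
      cylinder C t c ∩ {ω | channelPath C ω (t + 1) = c'} := by
    intro c
    ext ω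
    constructor
    · exact fun h => ⟨fun s hs => (h s (by omega)).trans (hx1 c s hs),
        (h (t + 1) le_rfl).trans (hx2 c)⟩
    · rintro ⟨h1, h2⟩ s hs
      rcases hs.eq_or_lt with rfl | hs
      · exact h2.trans (hx2 c).symm
      · exact (h1 s (by omega)).trans (hx1 c s (by omega)).symm
  have hmset : MeasurableSet {ω | channelPath C ω (t + 1) = c'} :=
    ((measurable_pi_apply (t + 1)).comp hin.measurable_channelPath) (measurableSet_singleton c')
  -- the two integrands on a cylinder
  have e1 : ∀ c, Set.EqOn (fun ω => F (arrivalPath A ω) (channelPath C ω) *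
      (if channelPath C ω (t + 1) = c' then 1 else 0))
      ({ω | channelPath C ω (t + 1) = c'}.indicator fun ω => F (arrivalPath A ω) c)
      (cylinder C t c) := by
    intro c ω hω
    have := hcongr (arrivalPath A ω) _ c hω
    by_cases h : channelPath C ω (t + 1) = c'
    · simp [Set.indicator, h, this]
    · simp [Set.indicator, h]
  have e2 : ∀ c, Set.EqOn (fun ω => F (arrivalPath A ω) (channelPath C ω) *
      ∏ i, chanProb ε (channelPath C ω t i) (c' i))
      (fun ω => F (arrivalPath A ω) c * ∏ i, chanProb ε (c t i) (c' i)) (cylinder C t c) := by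
    intro c ω hω
    have := hcongr (arrivalPath A ω) _ c hω
    simp only [this, hω t le_rfl]
  -- Partition by the channel path up to slot `t`; on each piece both integrals factor, and the
  -- Markov property compares the probabilities.
  rw [(integral_eq_sum_cylinder hin (t := t) fun p => ?_).2,
    (integral_eq_sum_cylinder hin (t := t) fun p => ?_).2]
  · refine Finset.sum_congr rfl fun p _ => ?_
    rw [setIntegral_congr_fun (hms _ _) (e1 _), setIntegral_congr_fun (hms _ _) (e2 _),
      setIntegral_indicator hmset, ← hext, integral_mul_const, hmul, hmul, hin.real_cylinder_succ]
    have h3 : cylinder C t (ext (extendPath p)) = cylinder C t (extendPath p) := by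
      ext ω
      refine forall₂_congr fun s hs => ?_
      rw [hx1 _ _ hs]
    rw [hx1 _ _ le_rfl, hx2, h3]
    ring
  · exact (((hint _).mul_const _).integrableOn).congr_fun (e2 _).symm (hms _ _)
  · exact ((hint _).indicator hmset).integrableOn.congr_fun (e1 _).symm (hms _ _)

end Channel

/-! ### Integrals over a frame -/

lemma measurable_cast_real {α : Type*} [MeasurableSpace α] {f : α → ℕ} (hf : Measurable f) :
    Measurable fun x => (f x : ℝ) :=
  (measurable_of_countable (Nat.cast : ℕ → ℝ)).comp hf

section Frame

variable {Ω : Type*} [MeasurableSpace Ω] {μ : Measure Ω} {ε : ℝ} {lam : Fin 2 → ℝ}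
  {A : Fin 2 → ℕ → Ω → ℕ} {C : Fin 2 → ℕ → Ω → Bool}

lemma IsSystemInput.exists_second_moment (hin : IsSystemInput μ ε lam A C) :
    ∃ B : ℝ, ∀ i t, Integrable (fun ω => (A i t ω : ℝ) ^ 2) μ ∧ ∫ ω, (A i t ω : ℝ) ^ 2 ∂μ ≤ B := by
  choose B hB using fun i => (hin.arrival i).second_moment
  refine ⟨max (B 0) (B 1), fun i t => ?_⟩
  have hm : Measurable fun ω => (A i t ω : ℝ) ^ 2 :=
    (measurable_cast_real ((hin.arrival i).measurable t)).pow_const 2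
  have h1 : ∫⁻ ω, ENNReal.ofReal ((A i t ω : ℝ) ^ 2) ∂μ ≤ B i := by
    refine le_trans (le_of_eq (lintegral_congr fun ω => ?_)) (hB i t)
    rw [ENNReal.ofReal_pow (by positivity), ENNReal.ofReal_natCast]
  have h2 : (B i : ℝ) ≤ max (B 0 : ℝ) (B 1) := by fin_cases i <;> simp
  constructor
  · refine ⟨hm.aestronglyMeasurable, ?_⟩
    rw [hasFiniteIntegral_iff_ofReal (Eventually.of_forall fun ω => by positivity)]
    exact h1.trans_lt ENNReal.coe_lt_top
  · rw [integral_eq_lintegral_of_nonneg_ae (Eventually.of_forall fun ω => by positivity)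
      hm.aestronglyMeasurable]
    exact (ENNReal.toReal_le_coe_of_le_coe h1).trans h2

lemma IsSystemInput.memLp_arrival (hin : IsSystemInput μ ε lam A C) (i : Fin 2) (t : ℕ) :
    MemLp (fun ω => (A i t ω : ℝ)) 2 μ := by
  obtain ⟨B, hB⟩ := hin.exists_second_moment
  have hm : Measurable fun ω => (A i t ω : ℝ) :=
    measurable_cast_real ((hin.arrival i).measurable t)
  exact (memLp_two_iff_integrable_sq hm.aestronglyMeasurable).2 (hB i t).1

variable (T : ℕ) (m₀ : Fin 2) (q₀ : Fin 2 → ℕ)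

lemma IsSystemInput.measurable_run (hin : IsSystemInput μ ε lam A C)
    {c : Ω → ℕ → Fin 2 → Bool} (hc : Measurable c) (t : ℕ) :
    Measurable fun ω => myopicRun ε T m₀ q₀ (arrivalPath A ω) (c ω) t :=
  measurable_myopicRun ε T m₀ q₀ (a := fun s i => A i s) (c := fun s i ω => c ω s i) t
    (fun s _ i => (hin.arrival i).measurable s)
    (fun s _ i => (measurable_pi_apply i).comp ((measurable_pi_apply s).comp hc))

variable [IsProbabilityMeasure μ]

lemma IsSystemInput.memLp_add_sum_arrival (hin : IsSystemInput μ ε lam A C) (q : ℝ) (i : Fin 2)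
    (t : ℕ) : MemLp (fun ω => q + ∑ s ∈ Finset.range t, (A i s ω : ℝ)) 2 μ := by
  have h1 : MemLp (fun ω => ∑ s ∈ Finset.range t, (A i s ω : ℝ)) 2 μ :=
    memLp_finsetSum _ fun s _ => hin.memLp_arrival i s
  have h2 : MemLp (fun _ : Ω => q) 2 μ := memLp_const q
  exact h2.add h1

lemma IsSystemInput.memLp_queue (hin : IsSystemInput μ ε lam A C)
    {c : Ω → ℕ → Fin 2 → Bool} (hc : Measurable c) (t : ℕ) (i : Fin 2) :
    MemLp (fun ω => ((myopicRun ε T m₀ q₀ (arrivalPath A ω) (c ω) t).2 i : ℝ)) 2 μ := by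
  have h1 := hin.memLp_add_sum_arrival (q₀ i) i t
  have hm : Measurable fun ω =>
      ((myopicRun ε T m₀ q₀ (arrivalPath A ω) (c ω) t).2 i : ℝ) :=
    measurable_cast_real ((measurable_pi_apply i).comp (hin.measurable_run T m₀ q₀ hc t).snd)
  refine h1.mono' hm.aestronglyMeasurable (Eventually.of_forall fun ω => ?_)
  have h2 := queue_le ε T m₀ q₀ (arrivalPath A ω) (c ω) t i
  rw [Real.norm_of_nonneg (Nat.cast_nonneg _)]
  exact_mod_cast h2

/-- The path `c` is arbitrary, because both the true channel path and frozen deterministic paths are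
needed. -/
lemma IsSystemInput.integrable_of_le (hin : IsSystemInput μ ε lam A C)
    {c : Ω → ℕ → Fin 2 → Bool} (hc : Measurable c) {g : (Fin 2 → ℕ) → State → ℝ} {K : ℝ}
    (hg : ∀ w s, |g w s| ≤ K * ∑ i, (w i : ℝ)) (t u : ℕ) :
    Integrable (fun ω => g (myopicRun ε T m₀ q₀ (arrivalPath A ω) (c ω) t).2
      (slotState ε T m₀ q₀ (arrivalPath A ω) (c ω) u)) μ := by
  have hm : Measurable fun ω => g (myopicRun ε T m₀ q₀ (arrivalPath A ω) (c ω) t).2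
      (slotState ε T m₀ q₀ (arrivalPath A ω) (c ω) u) := by
    have h1 := (hin.measurable_run T m₀ q₀ hc t).snd
    have h2 := (hin.measurable_run T m₀ q₀ hc u).fst
    have h3 := (measurable_pi_apply u).comp hc
    exact (measurable_of_countable fun x : (Fin 2 → ℕ) × State => g x.1 x.2).comp
      (h1.prodMk (h2.prodMk h3))
  have h1 : Integrable (fun ω => K * ∑ i,
      ((myopicRun ε T m₀ q₀ (arrivalPath A ω) (c ω) t).2 i : ℝ)) μ :=
    (integrable_finsetSum _ fun i _ =>
      (hin.memLp_queue T m₀ q₀ hc t i).integrable (by norm_num)).const_mul _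
  exact h1.mono' hm.aestronglyMeasurable (Eventually.of_forall fun ω => hg _ _)

/-- The Markov property of the channels, given the past of the queues. -/
lemma IsSystemInput.integral_next_channel (hin : IsSystemInput μ ε lam A C)
    {φ : (Fin 2 → ℕ) → State → (Fin 2 → Bool) → ℝ} {K : ℝ}
    (hφ : ∀ w s c, |φ w s c| ≤ K * ∑ i, (w i : ℝ)) {u t : ℕ} (hu : u ≤ t) :
    ∫ ω, φ (myopicRun ε T m₀ q₀ (arrivalPath A ω) (channelPath C ω) u).2
        (slotState ε T m₀ q₀ (arrivalPath A ω) (channelPath C ω) t)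
        (channelPath C ω (t + 1)) ∂μ =
      ∫ ω, ∑ c' : Fin 2 → Bool,
        (∏ i, chanProb ε (channelPath C ω t i) (c' i)) *
        φ (myopicRun ε T m₀ q₀ (arrivalPath A ω) (channelPath C ω) u).2
          (slotState ε T m₀ q₀ (arrivalPath A ω) (channelPath C ω) t) c' ∂μ := by
  let F : (Fin 2 → Bool) → (ℕ → Fin 2 → ℕ) → (ℕ → Fin 2 → Bool) → ℝ := fun c' a c =>
    φ (myopicRun ε T m₀ q₀ a c u).2 (slotState ε T m₀ q₀ a c t) c'
  have hF : ∀ c' c, Measurable fun a => F c' a c := by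
    intro c' c
    have hr : ∀ u, Measurable fun a : ℕ → Fin 2 → ℕ => myopicRun ε T m₀ q₀ a c u := fun u =>
      measurable_myopicRun ε T m₀ q₀ (a := fun s i (a : ℕ → Fin 2 → ℕ) => a s i) (c := fun s i _ => c s i) u
        (fun s _ i => (measurable_pi_apply i).comp (measurable_pi_apply s))
        (fun s _ i => measurable_const)
    exact (measurable_of_countable fun x : (Fin 2 → ℕ) × State => φ x.1 x.2 c').comp
      ((hr u).snd.prodMk ((hr t).fst.prodMk measurable_const))
  have hcongr : ∀ c' a c c₂, (∀ s ≤ t, c s = c₂ s) → F c' a c = F c' a c₂ := by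
    intro c' a c c₂ h
    have h1 := myopicRun_congr ε T m₀ q₀ a c (a' := a) (c' := c₂) u (fun _ _ => rfl)
      (fun s hs => h s (by omega))
    have h2 := myopicRun_congr ε T m₀ q₀ a c (a' := a) (c' := c₂) t (fun _ _ => rfl)
      (fun s hs => h s (by omega))
    simp only [F, slotState, h1, h2, h t le_rfl]
  have hint : ∀ c' c, Integrable (fun ω => F c' (arrivalPath A ω) c) μ := fun c' c =>
    hin.integrable_of_le T m₀ q₀ (c := fun _ => c) measurable_const
      (g := fun w s => φ w s c') (fun w s => hφ w s c') u t
  have hint' : ∀ c', Integrable (fun ω => F c' (arrivalPath A ω) (channelPath C ω)) μ := fun c' =>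
    hin.integrable_of_le T m₀ q₀ hin.measurable_channelPath
      (g := fun w s => φ w s c') (fun w s => hφ w s c') u t
  have hms : ∀ c', MeasurableSet {ω | channelPath C ω (t + 1) = c'} := fun c' =>
    ((measurable_pi_apply (t + 1)).comp hin.measurable_channelPath) (measurableSet_singleton c')
  have hL : ∀ c', Integrable (fun ω => F c' (arrivalPath A ω) (channelPath C ω) *
      (if channelPath C ω (t + 1) = c' then 1 else 0)) μ := by
    intro c'
    refine ((hint' c').indicator (hms c')).congr (Eventually.of_forall fun ω => ?_)
    by_cases h : channelPath C ω (t + 1) = c' <;> simp [Set.indicator, h]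
  have hR : ∀ c', Integrable (fun ω => F c' (arrivalPath A ω) (channelPath C ω) *
      ∏ i, chanProb ε (channelPath C ω t i) (c' i)) μ := by
    intro c'
    have hm : Measurable fun ω => ∏ i, chanProb ε (channelPath C ω t i) (c' i) :=
      (measurable_of_countable fun x : Fin 2 → Bool => ∏ i, chanProb ε (x i) (c' i)).comp
        ((measurable_pi_apply t).comp hin.measurable_channelPath)
    refine (hint' c').mul_bdd (c := ∑ x : Fin 2 → Bool, ‖∏ i, chanProb ε (x i) (c' i)‖)
      hm.aestronglyMeasurable (Eventually.of_forall fun ω => ?_)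
    exact Finset.single_le_sum (f := fun x : Fin 2 → Bool => ‖∏ i, chanProb ε (x i) (c' i)‖)
      (fun _ _ => norm_nonneg _) (Finset.mem_univ _)
  -- Decompose according to the value of the next channel state and condition on the past for each
  -- value.
  calc _ = ∫ ω, ∑ c', F c' (arrivalPath A ω) (channelPath C ω) *
        (if channelPath C ω (t + 1) = c' then 1 else 0) ∂μ := by
        refine integral_congr_ae (Eventually.of_forall fun ω => ?_)
        simp [F]
    _ = ∑ c', ∫ ω, F c' (arrivalPath A ω) (channelPath C ω) *
        (if channelPath C ω (t + 1) = c' then 1 else 0) ∂μ := integral_finsetSum _ fun c' _ => hL c'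
    _ = ∑ c', ∫ ω, F c' (arrivalPath A ω) (channelPath C ω) *
        ∏ i, chanProb ε (channelPath C ω t i) (c' i) ∂μ :=
        Finset.sum_congr rfl fun c' _ =>
          hin.integral_channel_step t (hF c') (hcongr c') (hint c') c'
    _ = _ := by
        rw [← integral_finsetSum _ fun c' _ => hR c']
        simp only [F, mul_comm]

/-- The arrivals in a slot are uncorrelated with the earlier queue lengths, when the other arrivals `b` and the channels `c` are fixed. -/
lemma IsSystemInput.integral_queue_mul_arrival_of_fixed (hin : IsSystemInput μ ε lam A C)
    (i : Fin 2) {u t : ℕ} (hu : u ≤ t) (b : ℕ → ℕ) (c : ℕ → Fin 2 → Bool) :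
    ∫ ω, ((myopicRun ε T m₀ q₀ (fun s j => if j = i then A i s ω else b s) c u).2 i : ℝ) *
        A i t ω ∂μ =
      lam i * ∫ ω,
        ((myopicRun ε T m₀ q₀ (fun s j => if j = i then A i s ω else b s) c u).2 i : ℝ) ∂μ := by
  let G : Ω → ℝ := fun ω =>
    (myopicRun ε T m₀ q₀ (fun s j => if j = i then A i s ω else b s) c u).2 i
  have hle : (⨆ s, ⨆ _ : s < t, MeasurableSpace.comap (A i s) inferInstance) ≤
      ‹MeasurableSpace Ω› := iSup₂_le fun s _ => ((hin.arrival i).measurable s).comap_le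
  have hs : StronglyMeasurable[⨆ s, ⨆ _ : s < t, MeasurableSpace.comap (A i s) inferInstance]
      fun ω => G ω := by
    have hm : ∀ s < t, Measurable[⨆ s, ⨆ _ : s < t, MeasurableSpace.comap (A i s) inferInstance]
        (A i s) := fun s hs =>
      (comap_measurable (A i s)).mono (le_iSup₂_of_le s hs le_rfl) le_rfl
    revert hm
    generalize (⨆ s, ⨆ _ : s < t, MeasurableSpace.comap (A i s) inferInstance) = m
    intro hm
    have := @measurable_myopicRun Ω m ε T m₀ q₀
      (fun s j ω => if j = i then A i s ω else b s) (fun s j _ => c s j) u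
      (fun s hs j => by
        by_cases h : j = i
        · simp only [h, if_true]; exact hm s (by omega)
        · simp only [h, if_false]; exact measurable_const)
      (fun s _ j => measurable_const)
    exact (measurable_cast_real ((measurable_pi_apply i).comp this.snd)).stronglyMeasurable
  have hGm : AEStronglyMeasurable G μ := (hs.mono hle).aestronglyMeasurable
  have hL : MemLp (fun ω => G ω) 2 μ := by
    have h1 := hin.memLp_add_sum_arrival (q₀ i) i u
    refine h1.mono' hGm (Eventually.of_forall fun ω => ?_)
    have h2 := queue_le ε T m₀ q₀ (fun s j => if j = i then A i s ω else b s) c u i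
    rw [Real.norm_of_nonneg (Nat.cast_nonneg _)]
    simp only [if_true] at h2
    exact_mod_cast h2
  have hLA := hL.integrable_mul (hin.memLp_arrival i t)
  -- With the rest frozen, the queue is a function of its own arrivals before slot `t`, so it can be
  -- pulled out of the conditional expectation.
  have hce := condExp_mul_of_stronglyMeasurable_left hs hLA
    ((hin.memLp_arrival i t).integrable (by norm_num))
  have hmean := (hin.arrival i).mean t
  calc ∫ ω, G ω * (A i t ω : ℝ) ∂μ
      = ∫ ω, (μ[(fun ω => G ω) * (fun ω => (A i t ω : ℝ)) |
          ⨆ s, ⨆ _ : s < t, MeasurableSpace.comap (A i s) inferInstance]) ω ∂μ := by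
        rw [integral_condExp hle]; rfl
    _ = ∫ ω, lam i * G ω ∂μ := by
        refine integral_congr_ae ?_
        filter_upwards [hce, hmean] with ω h1 h2
        rw [h1, Pi.mul_apply, h2, mul_comm]
    _ = _ := integral_const_mul _ _

/-- The arrivals in a slot are uncorrelated with the earlier queue lengths. -/
lemma IsSystemInput.integral_queue_mul_arrival (hin : IsSystemInput μ ε lam A C) (i : Fin 2)
    {u t : ℕ} (hu : u ≤ t) :
    ∫ ω, ((myopicRun ε T m₀ q₀ (arrivalPath A ω) (channelPath C ω) u).2 i : ℝ) * A i t ω ∂μ =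
      lam i * ∫ ω, ((myopicRun ε T m₀ q₀ (arrivalPath A ω) (channelPath C ω) u).2 i : ℝ) ∂μ := by
  -- The conditional mean of the arrivals is known only given their own past, whereas the queue also
  -- depends on the other arrivals and the channels. These are collected in `Y`, independent of `X`,
  -- and frozen by Fubini.
  let X : Ω → ℕ → ℕ := fun ω t => A i t ω
  let Y : Ω → (ℕ → ℕ) × (ℕ → Fin 2 → Bool) := fun ω => (fun t => A (i + 1) t ω, channelPath C ω)
  have hX : Measurable X := measurable_pi_lambda _ fun t => (hin.arrival i).measurable t
  have hY : Measurable Y := (measurable_pi_lambda _ fun t =>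
    (hin.arrival (i + 1)).measurable t).prodMk hin.measurable_channelPath
  have hne : i + 1 ≠ i := by fin_cases i <;> decide
  have hXY : IndepFun X Y μ := by
    have h := indep_iSup_of_disjoint hin.inputAlgebra_le hin.indep
      (S := {Sum.inl i}) (T := {Sum.inl i}ᶜ) disjoint_compl_right
    refine indep_of_indep_of_le_left (indep_of_indep_of_le_right h ?_) ?_
    · have hle : ∀ k : Fin 2 ⊕ Fin 2, k ≠ Sum.inl i → inputAlgebra A C k ≤
          ⨆ k ∈ ({Sum.inl i}ᶜ : Set (Fin 2 ⊕ Fin 2)), inputAlgebra A C k := fun k hk =>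
        le_iSup₂_of_le k hk le_rfl
      generalize (⨆ k ∈ ({Sum.inl i}ᶜ : Set (Fin 2 ⊕ Fin 2)), inputAlgebra A C k) = m at hle
      refine Measurable.comap_le (Measurable.prodMk ?_ ?_)
      · exact @measurable_pi_lambda _ _ _ m _ _ fun t =>
          measurable_arrival (i + 1) t (hle _ (by simp))
      · exact @measurable_pi_lambda _ _ _ m _ _ fun t => @measurable_pi_lambda _ _ _ m _ _ fun j =>
          measurable_channel j t (hle _ (by simp))
    · exact le_iSup₂_of_le (Sum.inl i) rfl le_rfl
  let G : (ℕ → ℕ) → (ℕ → ℕ) × (ℕ → Fin 2 → Bool) → ℝ := fun x y =>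
    (myopicRun ε T m₀ q₀ (fun s j => if j = i then x s else y.1 s) y.2 u).2 i
  have hG : Measurable fun z : (ℕ → ℕ) × (ℕ → ℕ) × (ℕ → Fin 2 → Bool) => G z.1 z.2 := by
    have := measurable_myopicRun ε T m₀ q₀
      (Ω := (ℕ → ℕ) × (ℕ → ℕ) × (ℕ → Fin 2 → Bool))
      (a := fun s j z => if j = i then z.1 s else z.2.1 s) (c := fun s j z => z.2.2 s j) u
      (fun s _ j => by
        by_cases h : j = i
        · simp only [h, if_true]; exact (measurable_pi_apply s).comp measurable_fst
        · simp only [h, if_false]; exact (measurable_pi_apply s).comp measurable_snd.fst)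
      (fun s _ j => (measurable_pi_apply j).comp ((measurable_pi_apply s).comp measurable_snd.snd))
    exact measurable_cast_real ((measurable_pi_apply i).comp this.snd)
  have hpath : ∀ ω, (fun s j => if j = i then X ω s else (Y ω).1 s) = arrivalPath A ω := by
    intro ω
    funext s j
    by_cases h : j = i
    · simp [h, X, arrivalPath]
    · have : j = i + 1 := by
        revert h; fin_cases i <;> fin_cases j <;> decide
      simp [Y, arrivalPath, this]
  have hGXY : ∀ ω, G (X ω) (Y ω) =
      (myopicRun ε T m₀ q₀ (arrivalPath A ω) (channelPath C ω) u).2 i := by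
    intro ω
    simp only [G, hpath]
    rfl
  have hQ := hin.memLp_queue T m₀ q₀ hin.measurable_channelPath u i
  have hQA := hQ.integrable_mul (hin.memLp_arrival i t)
  have hprod := (indepFun_iff_map_prod_eq_prod_map_map hX.aemeasurable hY.aemeasurable).1 hXY
  have hpair : Measurable fun ω => (X ω, Y ω) := hX.prodMk hY
  have hcast : Measurable fun z : (ℕ → ℕ) × (ℕ → ℕ) × (ℕ → Fin 2 → Bool) => (z.1 t : ℝ) :=
    measurable_cast_real ((measurable_pi_apply t).comp measurable_fst)
  have hGc : Measurable fun z : (ℕ → ℕ) × (ℕ → ℕ) × (ℕ → Fin 2 → Bool) =>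
      G z.1 z.2 * (z.1 t : ℝ) := hG.mul hcast
  have hprob : IsProbabilityMeasure (μ.map X) := Measure.isProbabilityMeasure_map hX.aemeasurable
  have hprob' : IsProbabilityMeasure (μ.map Y) := Measure.isProbabilityMeasure_map hY.aemeasurable
  have i1 : Integrable (fun z : (ℕ → ℕ) × (ℕ → ℕ) × (ℕ → Fin 2 → Bool) => G z.1 z.2 * z.1 t)
      ((μ.map X).prod (μ.map Y)) := by
    rw [← hprod, integrable_map_measure hGc.aestronglyMeasurable hpair.aemeasurable]
    refine hQA.congr (Eventually.of_forall fun ω => ?_)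
    simp only [Function.comp, hGXY]
    rfl
  have i2 : Integrable (fun z : (ℕ → ℕ) × (ℕ → ℕ) × (ℕ → Fin 2 → Bool) => G z.1 z.2)
      ((μ.map X).prod (μ.map Y)) := by
    rw [← hprod, integrable_map_measure hG.aestronglyMeasurable hpair.aemeasurable]
    refine (hQ.integrable (by norm_num)).congr (Eventually.of_forall fun ω => ?_)
    simp only [Function.comp, hGXY]
  have inner : ∀ y, ∫ x, G x y * x t ∂(μ.map X) = lam i * ∫ x, G x y ∂(μ.map X) := by
    intro y
    have hGy : Measurable fun x => G x y := hG.comp (measurable_id.prodMk measurable_const)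
    have hc1 : Measurable fun x : ℕ → ℕ => G x y * (x t : ℝ) :=
      hGy.mul (measurable_cast_real (measurable_pi_apply t))
    rw [integral_map hX.aemeasurable hc1.aestronglyMeasurable,
      integral_map hX.aemeasurable hGy.aestronglyMeasurable]
    exact hin.integral_queue_mul_arrival_of_fixed T m₀ q₀ i hu y.1 y.2
  calc _ = ∫ ω, G (X ω) (Y ω) * X ω t ∂μ := by simp only [hGXY]; rfl
    _ = ∫ z, G z.1 z.2 * z.1 t ∂(μ.map fun ω => (X ω, Y ω)) :=
        (integral_map hpair.aemeasurable hGc.aestronglyMeasurable).symm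
    _ = ∫ y, ∫ x, G x y * x t ∂(μ.map X) ∂(μ.map Y) := by
        rw [hprod]; exact integral_prod_symm _ i1
    _ = lam i * ∫ y, ∫ x, G x y ∂(μ.map X) ∂(μ.map Y) := by
        simp only [inner]; exact integral_const_mul _ _
    _ = lam i * ∫ z, G z.1 z.2 ∂(μ.map fun ω => (X ω, Y ω)) := by
        rw [hprod]; congr 1; exact (integral_prod_symm _ i2).symm
    _ = lam i * ∫ ω, G (X ω) (Y ω) ∂μ := by
        rw [integral_map hpair.aemeasurable hG.aestronglyMeasurable]
    _ = _ := by simp only [hGXY]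

end Frame

/-! ### The drift over a frame -/

lemma sum_stateProb_mul (ε : ℝ) (s : State) (a : Bool) (f : State → ℝ) :
    ∑ s', stateProb ε s a s' * f s' =
      ∑ c' : Fin 2 → Bool, (∏ i, chanProb ε (s.2 i) (c' i)) * f (nextServer s.1 a, c') := by
  rw [Fintype.sum_prod_type, Finset.sum_comm]
  refine Finset.sum_congr rfl fun c' _ => ?_
  simp [stateProb, ite_mul]

lemma reward_nonneg (i : Fin 2) (s : State) (a : Bool) : 0 ≤ reward i s a := by
  unfold reward; split_ifs <;> norm_num

lemma reward_le_one (i : Fin 2) (s : State) (a : Bool) : reward i s a ≤ 1 := by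
  unfold reward; split_ifs <;> norm_num

lemma slotState_succ (ε : ℝ) {T : ℕ} (m₀ : Fin 2) (q₀ : Fin 2 → ℕ) (a : ℕ → Fin 2 → ℕ)
    (c : ℕ → Fin 2 → Bool) (j : ℕ) {k : ℕ} (hk : k < T) :
    slotState ε T m₀ q₀ a c (T * j + k + 1) =
      (nextServer (slotState ε T m₀ q₀ a c (T * j + k)).1
        (stayAt ε (myopicRun ε T m₀ q₀ a c (T * j)).2 (slotState ε T m₀ q₀ a c (T * j + k))),
       c (T * j + k + 1)) := by
  rw [slotState, myopicRun_succ, frame_start hk]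
  rfl

section Drift

variable {Ω : Type*} [MeasurableSpace Ω] {μ : Measure Ω} [IsProbabilityMeasure μ] {ε : ℝ}
  {lam : Fin 2 → ℝ} {A : Fin 2 → ℕ → Ω → ℕ} {C : Fin 2 → ℕ → Ω → Bool} (T : ℕ) (m₀ : Fin 2)
  (q₀ : Fin 2 → ℕ)

lemma IsSystemInput.integrable_queue_mul_reward (hin : IsSystemInput μ ε lam A C) (i : Fin 2)
    (u t : ℕ) : Integrable (fun ω =>
      ((myopicRun ε T m₀ q₀ (arrivalPath A ω) (channelPath C ω) u).2 i : ℝ) *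
        reward i (slotState ε T m₀ q₀ (arrivalPath A ω) (channelPath C ω) t)
          (stayAt ε (myopicRun ε T m₀ q₀ (arrivalPath A ω) (channelPath C ω) u).2
            (slotState ε T m₀ q₀ (arrivalPath A ω) (channelPath C ω) t))) μ := by
  refine hin.integrable_of_le T m₀ q₀ hin.measurable_channelPath (K := 1)
    (g := fun w s => (w i : ℝ) * reward i s (stayAt ε w s)) (fun w s => ?_) u t
  rw [abs_mul, abs_of_nonneg (reward_nonneg _ _ _), abs_of_nonneg (Nat.cast_nonneg _), one_mul]
  have h1 : (w i : ℝ) ≤ ∑ i, (w i : ℝ) :=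
    Finset.single_le_sum (f := fun i => (w i : ℝ)) (fun _ _ => Nat.cast_nonneg _)
      (Finset.mem_univ i)
  exact (mul_le_of_le_one_right (Nat.cast_nonneg _) (reward_le_one _ _ _)).trans h1

/-- The pointwise drift inequality, integrated. Throughout the frame the potential is the one for
the weights at its start, so its increments telescope over the slots. -/
lemma IsSystemInput.slot_drift (hin : IsSystemInput μ ε lam A C) {c₀ : ℝ} (hc₀ : 0 ≤ c₀)
    {H : (Fin 2 → ℕ) → State → ℝ} (hH : ∀ w s, |H w s| ≤ c₀ * ∑ i, (w i : ℝ)) {r : Fin 2 → ℝ}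
    (hr : ∀ (w : Fin 2 → ℕ) (s : State), 9 / 10 * ∑ i, (w i : ℝ) * r i ≤
      ∑ i, (w i : ℝ) * reward i s (stayAt ε w s) + ∑ s', stateProb ε s (stayAt ε w s) s' * H w s'
        - H w s) (j : ℕ) {k : ℕ} (hk : k < T) :
    9 / 10 * ∑ i, (∫ ω, ((myopicRun ε T m₀ q₀ (arrivalPath A ω) (channelPath C ω)
        (T * j)).2 i : ℝ) ∂μ) * r i ≤
      ∑ i, ∫ ω, ((myopicRun ε T m₀ q₀ (arrivalPath A ω) (channelPath C ω) (T * j)).2 i : ℝ) *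
        reward i (slotState ε T m₀ q₀ (arrivalPath A ω) (channelPath C ω) (T * j + k))
          (stayAt ε (myopicRun ε T m₀ q₀ (arrivalPath A ω) (channelPath C ω) (T * j)).2
            (slotState ε T m₀ q₀ (arrivalPath A ω) (channelPath C ω) (T * j + k))) ∂μ +
      ∫ ω, H (myopicRun ε T m₀ q₀ (arrivalPath A ω) (channelPath C ω) (T * j)).2
        (slotState ε T m₀ q₀ (arrivalPath A ω) (channelPath C ω) (T * j + (k + 1))) ∂μ -
      ∫ ω, H (myopicRun ε T m₀ q₀ (arrivalPath A ω) (channelPath C ω) (T * j)).2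
        (slotState ε T m₀ q₀ (arrivalPath A ω) (channelPath C ω) (T * j + k)) ∂μ := by
  have hcm := hin.measurable_channelPath
  let φ : (Fin 2 → ℕ) → State → (Fin 2 → Bool) → ℝ := fun w s c' =>
    H w (nextServer s.1 (stayAt ε w s), c')
  have hstep := hin.integral_next_channel T m₀ q₀ (φ := φ) (fun w s c' => hH w _)
    (u := T * j) (t := T * j + k) (by omega)
  have hsucc : ∀ ω, H (myopicRun ε T m₀ q₀ (arrivalPath A ω) (channelPath C ω) (T * j)).2
        (slotState ε T m₀ q₀ (arrivalPath A ω) (channelPath C ω) (T * j + (k + 1))) =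
      φ (myopicRun ε T m₀ q₀ (arrivalPath A ω) (channelPath C ω) (T * j)).2
        (slotState ε T m₀ q₀ (arrivalPath A ω) (channelPath C ω) (T * j + k))
        (channelPath C ω (T * j + k + 1)) := by
    intro ω
    rw [← add_assoc, slotState_succ ε m₀ q₀ _ _ j hk]
  have hE : ∫ ω, H (myopicRun ε T m₀ q₀ (arrivalPath A ω) (channelPath C ω) (T * j)).2
        (slotState ε T m₀ q₀ (arrivalPath A ω) (channelPath C ω) (T * j + (k + 1))) ∂μ =
      ∫ ω, (fun (w : Fin 2 → ℕ) (s : State) => ∑ s', stateProb ε s (stayAt ε w s) s' * H w s')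
        (myopicRun ε T m₀ q₀ (arrivalPath A ω) (channelPath C ω) (T * j)).2
        (slotState ε T m₀ q₀ (arrivalPath A ω) (channelPath C ω) (T * j + k)) ∂μ := by
    simp only [hsucc, sum_stateProb_mul]
    exact hstep
  have iQ : ∀ i, Integrable (fun ω => ((myopicRun ε T m₀ q₀ (arrivalPath A ω) (channelPath C ω)
      (T * j)).2 i : ℝ)) μ := fun i =>
    (hin.memLp_queue T m₀ q₀ hcm (T * j) i).integrable (by norm_num)
  have iR := fun i => hin.integrable_queue_mul_reward T m₀ q₀ i (T * j) (T * j + k)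
  have iE := hin.integrable_of_le T m₀ q₀ hcm
    (K := (∑ s : State, ∑ a : Bool, ∑ s' : State, |stateProb ε s a s'|) * c₀)
    (g := fun w s => ∑ s', stateProb ε s (stayAt ε w s) s' * H w s') (fun w s => ?_)
    (T * j) (T * j + k)
  · have iH := hin.integrable_of_le T m₀ q₀ hcm hH (T * j) (T * j + k)
    have iS := integrable_finsetSum Finset.univ fun i _ => iR i
    have iL := (integrable_finsetSum Finset.univ fun i _ => (iQ i).mul_const (r i)).const_mul
      (9 / 10)
    have := integral_mono iL ((iS.add iE).sub iH) (fun ω => hr _ _)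
    rw [integral_const_mul, integral_finsetSum _ fun i _ => (iQ i).mul_const (r i)] at this
    simp only [integral_mul_const] at this
    refine this.trans (le_of_eq ?_)
    rw [hE, ← integral_finsetSum _ fun i _ => iR i, ← integral_add iS iE]
    exact integral_sub (iS.add iE) iH
  · have h0 : 0 ≤ ∑ i, (w i : ℝ) := Finset.sum_nonneg fun _ _ => Nat.cast_nonneg _
    calc |∑ s', stateProb ε s (stayAt ε w s) s' * H w s'|
        ≤ ∑ s', |stateProb ε s (stayAt ε w s) s'| * (c₀ * ∑ i, (w i : ℝ)) := by
          refine (Finset.abs_sum_le_sum_abs _ _).trans (Finset.sum_le_sum fun s' _ => ?_)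
          rw [abs_mul]
          exact mul_le_mul_of_nonneg_left (hH _ _) (abs_nonneg _)
      _ = (∑ s', |stateProb ε s (stayAt ε w s) s'|) * (c₀ * ∑ i, (w i : ℝ)) :=
          (Finset.sum_mul _ _ _).symm
      _ ≤ (∑ s : State, ∑ a : Bool, ∑ s' : State, |stateProb ε s a s'|) *
          (c₀ * ∑ i, (w i : ℝ)) := by
          refine mul_le_mul_of_nonneg_right ?_ (mul_nonneg hc₀ h0)
          refine (Finset.single_le_sum (f := fun a => ∑ s' : State, |stateProb ε s a s'|)
            (fun _ _ => Finset.sum_nonneg fun _ _ => abs_nonneg _)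
            (Finset.mem_univ (stayAt ε w s))).trans ?_
          exact Finset.single_le_sum
            (f := fun s => ∑ a : Bool, ∑ s' : State, |stateProb ε s a s'|)
            (fun _ _ => Finset.sum_nonneg fun _ _ => Finset.sum_nonneg fun _ _ => abs_nonneg _)
            (Finset.mem_univ s)
      _ = _ := by ring

/-- Summing over the slots of a frame. -/
lemma IsSystemInput.frame_reward_ge (hin : IsSystemInput μ ε lam A C) {c₀ : ℝ} (hc₀ : 0 ≤ c₀)
    {H : (Fin 2 → ℕ) → State → ℝ} (hH : ∀ w s, |H w s| ≤ c₀ * ∑ i, (w i : ℝ)) {r : Fin 2 → ℝ}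
    (hr : ∀ (w : Fin 2 → ℕ) (s : State), 9 / 10 * ∑ i, (w i : ℝ) * r i ≤
      ∑ i, (w i : ℝ) * reward i s (stayAt ε w s) + ∑ s', stateProb ε s (stayAt ε w s) s' * H w s'
        - H w s) (j : ℕ) :
    T * (9 / 10 * ∑ i, (∫ ω, ((myopicRun ε T m₀ q₀ (arrivalPath A ω) (channelPath C ω)
        (T * j)).2 i : ℝ) ∂μ) * r i) ≤
      ∑ k ∈ Finset.range T, ∑ i,
        ∫ ω, ((myopicRun ε T m₀ q₀ (arrivalPath A ω) (channelPath C ω) (T * j)).2 i : ℝ) *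
        reward i (slotState ε T m₀ q₀ (arrivalPath A ω) (channelPath C ω) (T * j + k))
          (stayAt ε (myopicRun ε T m₀ q₀ (arrivalPath A ω) (channelPath C ω) (T * j)).2
            (slotState ε T m₀ q₀ (arrivalPath A ω) (channelPath C ω) (T * j + k))) ∂μ +
      2 * c₀ * ∑ i, ∫ ω, ((myopicRun ε T m₀ q₀ (arrivalPath A ω) (channelPath C ω)
        (T * j)).2 i : ℝ) ∂μ := by
  have hcm := hin.measurable_channelPath
  have h1 := Finset.sum_le_sum fun k hk =>
    hin.slot_drift T m₀ q₀ hc₀ hH hr j (k := k) (Finset.mem_range.1 hk)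
  rw [Finset.sum_const, Finset.card_range, nsmul_eq_mul] at h1
  simp only [add_sub_assoc] at h1
  rw [Finset.sum_add_distrib, Finset.sum_range_sub (fun k => ∫ ω,
    H (myopicRun ε T m₀ q₀ (arrivalPath A ω) (channelPath C ω) (T * j)).2
      (slotState ε T m₀ q₀ (arrivalPath A ω) (channelPath C ω) (T * j + k)) ∂μ)] at h1
  have iQ : ∀ i, Integrable (fun ω => ((myopicRun ε T m₀ q₀ (arrivalPath A ω) (channelPath C ω)
      (T * j)).2 i : ℝ)) μ := fun i =>
    (hin.memLp_queue T m₀ q₀ hcm (T * j) i).integrable (by norm_num)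
  have hb : ∀ k, |∫ ω, H (myopicRun ε T m₀ q₀ (arrivalPath A ω) (channelPath C ω) (T * j)).2
      (slotState ε T m₀ q₀ (arrivalPath A ω) (channelPath C ω) (T * j + k)) ∂μ| ≤
      c₀ * ∑ i, ∫ ω, ((myopicRun ε T m₀ q₀ (arrivalPath A ω) (channelPath C ω)
        (T * j)).2 i : ℝ) ∂μ := by
    intro k
    rw [← integral_finsetSum _ fun i _ => iQ i, ← integral_const_mul]
    refine abs_integral_le_integral_abs.trans ?_
    exact integral_mono (hin.integrable_of_le T m₀ q₀ hcm hH (T * j) (T * j + k)).abs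
      ((integrable_finsetSum _ fun i _ => iQ i).const_mul _) (fun ω => hH _ _)
  -- After telescoping only the potentials at the two ends of the frame remain.
  linarith [abs_le.1 (hb T), abs_le.1 (hb 0)]

/-- The drift of the sum of the squares of the queue lengths over a frame. -/
lemma IsSystemInput.frame_drift (hin : IsSystemInput μ ε lam A C) {c₀ : ℝ} (hc₀ : 0 ≤ c₀)
    {H : (Fin 2 → ℕ) → State → ℝ} (hH : ∀ w s, |H w s| ≤ c₀ * ∑ i, (w i : ℝ)) {r : Fin 2 → ℝ}
    (hr : ∀ (w : Fin 2 → ℕ) (s : State), 9 / 10 * ∑ i, (w i : ℝ) * r i ≤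
      ∑ i, (w i : ℝ) * reward i s (stayAt ε w s) + ∑ s', stateProb ε s (stayAt ε w s) s' * H w s'
        - H w s) {δ ξ : ℝ} (hδ : 2 * c₀ ≤ T * δ) (hlam : ∀ i, lam i + δ + ξ = 9 / 10 * r i)
    {B : ℝ} (hB : ∀ i t, ∫ ω, (A i t ω : ℝ) ^ 2 ∂μ ≤ B) (j : ℕ) :
    ∑ i, ∫ ω, ((myopicRun ε T m₀ q₀ (arrivalPath A ω) (channelPath C ω)
        (T * (j + 1))).2 i : ℝ) ^ 2 ∂μ ≤
      ∑ i, ∫ ω, ((myopicRun ε T m₀ q₀ (arrivalPath A ω) (channelPath C ω)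
        (T * j)).2 i : ℝ) ^ 2 ∂μ -
      2 * T * ξ * ∑ i, ∫ ω, ((myopicRun ε T m₀ q₀ (arrivalPath A ω) (channelPath C ω)
        (T * j)).2 i : ℝ) ∂μ + 2 * (T ^ 2 * B + 3 * T ^ 2) := by
  have hcm := hin.measurable_channelPath
  obtain ⟨B', hB'⟩ := hin.exists_second_moment
  have iR := fun i k => hin.integrable_queue_mul_reward T m₀ q₀ i (T * j) (T * j + k)
  have iA : ∀ i k, Integrable (fun ω =>
      ((myopicRun ε T m₀ q₀ (arrivalPath A ω) (channelPath C ω) (T * j)).2 i : ℝ) *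
        arrivalPath A ω (T * j + k) i) μ := fun i k =>
    (hin.memLp_queue T m₀ q₀ hcm (T * j) i).integrable_mul (hin.memLp_arrival i (T * j + k))
  have iQ2 : ∀ i t, Integrable (fun ω => ((myopicRun ε T m₀ q₀ (arrivalPath A ω)
      (channelPath C ω) t).2 i : ℝ) ^ 2) μ := fun i t =>
    (hin.memLp_queue T m₀ q₀ hcm t i).integrable_sq
  have iA2 : ∀ i t, Integrable (fun ω => (arrivalPath A ω t i : ℝ) ^ 2) μ := fun i t =>
    (hB' i t).1
  have queue : ∀ i, ∫ ω, ((myopicRun ε T m₀ q₀ (arrivalPath A ω) (channelPath C ω)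
        (T * (j + 1))).2 i : ℝ) ^ 2 ∂μ ≤
      ∫ ω, ((myopicRun ε T m₀ q₀ (arrivalPath A ω) (channelPath C ω) (T * j)).2 i : ℝ) ^ 2 ∂μ +
      2 * (T * (lam i * ∫ ω, ((myopicRun ε T m₀ q₀ (arrivalPath A ω) (channelPath C ω)
        (T * j)).2 i : ℝ) ∂μ)) -
      2 * ∑ k ∈ Finset.range T,
        ∫ ω, ((myopicRun ε T m₀ q₀ (arrivalPath A ω) (channelPath C ω) (T * j)).2 i : ℝ) *
        reward i (slotState ε T m₀ q₀ (arrivalPath A ω) (channelPath C ω) (T * j + k))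
          (stayAt ε (myopicRun ε T m₀ q₀ (arrivalPath A ω) (channelPath C ω) (T * j)).2
            (slotState ε T m₀ q₀ (arrivalPath A ω) (channelPath C ω) (T * j + k))) ∂μ +
      (T ^ 2 * B + 3 * T ^ 2) := by
    intro i
    have j1 := iQ2 i (T * j)
    have j2 := (integrable_finsetSum (Finset.range T) fun k _ => iA i k).const_mul 2
    have j3 := (integrable_finsetSum (Finset.range T) fun k _ => iR i k).const_mul 2
    have j4 := (integrable_finsetSum (Finset.range T) fun k _ =>
      iA2 i (T * j + k)).const_mul (T : ℝ)
    have j5 : Integrable (fun _ : Ω => 3 * (T : ℝ) ^ 2) μ := integrable_const _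
    have key := integral_mono (iQ2 i (T * (j + 1))) ((((j1.add j2).sub j3).add j4).add j5)
      (fun ω => sq_queue_le ε T m₀ q₀ (arrivalPath A ω) (channelPath C ω) j i)
    refine key.trans ?_
    rw [integral_add' (((j1.add j2).sub j3).add j4) j5, integral_add' ((j1.add j2).sub j3) j4,
      integral_sub' (j1.add j2) j3, integral_add' j1 j2, integral_const_mul, integral_const_mul,
      integral_const_mul, integral_finsetSum _ fun k _ => iA i k,
      integral_finsetSum _ fun k _ => iR i k, integral_finsetSum _ fun k _ => iA2 i (T * j + k)]
    have h1 : ∑ k ∈ Finset.range T, ∫ ω, ((myopicRun ε T m₀ q₀ (arrivalPath A ω)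
        (channelPath C ω) (T * j)).2 i : ℝ) * arrivalPath A ω (T * j + k) i ∂μ =
        T * (lam i * ∫ ω, ((myopicRun ε T m₀ q₀ (arrivalPath A ω) (channelPath C ω)
        (T * j)).2 i : ℝ) ∂μ) := by
      refine (Finset.sum_congr rfl fun k _ => hin.integral_queue_mul_arrival T m₀ q₀ i
        (u := T * j) (t := T * j + k) (by omega)).trans ?_
      simp
    have h2 : ∑ k ∈ Finset.range T, ∫ ω, (arrivalPath A ω (T * j + k) i : ℝ) ^ 2 ∂μ ≤ T * B := by
      refine (Finset.sum_le_sum fun k _ => hB i (T * j + k)).trans ?_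
      simp
    have h3 : ∫ _ : Ω, 3 * (T : ℝ) ^ 2 ∂μ = 3 * (T : ℝ) ^ 2 := by simp
    rw [h1, h3]
    nlinarith [mul_le_mul_of_nonneg_left h2 (Nat.cast_nonneg T : (0 : ℝ) ≤ T)]
  have hrew := hin.frame_reward_ge T m₀ q₀ hc₀ hH hr j
  rw [Finset.sum_comm] at hrew
  have hs := Finset.sum_le_sum fun i (_ : i ∈ Finset.univ) => queue i
  have hQ0 : ∀ i, 0 ≤ ∫ ω, ((myopicRun ε T m₀ q₀ (arrivalPath A ω) (channelPath C ω)
        (T * j)).2 i : ℝ) ∂μ := fun i => integral_nonneg fun ω => Nat.cast_nonneg _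
  have l0 : 9 / 10 * r 0 = lam 0 + δ + ξ := (hlam 0).symm
  have l1 : 9 / 10 * r 1 = lam 1 + δ + ξ := (hlam 1).symm
  simp only [Fin.sum_univ_two] at hs hrew ⊢
  set e0 := ∫ ω, ((myopicRun ε T m₀ q₀ (arrivalPath A ω) (channelPath C ω)
    (T * j)).2 0 : ℝ) ∂μ
  set e1 := ∫ ω, ((myopicRun ε T m₀ q₀ (arrivalPath A ω) (channelPath C ω)
    (T * j)).2 1 : ℝ) ∂μ
  have m0 : T * e0 * (9 / 10 * r 0) = T * e0 * (lam 0 + δ + ξ) := by rw [l0]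
  have m1 : T * e1 * (9 / 10 * r 1) = T * e1 * (lam 1 + δ + ξ) := by rw [l1]
  -- The margin δ, accumulated over T slots, absorbs the boundary term of the potential.
  have m2 := mul_le_mul_of_nonneg_right hδ (add_nonneg (hQ0 0) (hQ0 1))
  linarith

end Drift

/-! ### Stability -/

lemma stronglyStable_of_sum_le {Ω : Type*} [MeasurableSpace Ω] {μ : Measure Ω} {Q : ℕ → Ω → ℕ}
    (hQ : ∀ t, Integrable (fun ω => (Q t ω : ℝ)) μ) {M : ℝ}
    (hM : ∀ t : ℕ, 0 < t → ∑ τ ∈ Finset.range t, ∫ ω, (Q τ ω : ℝ) ∂μ ≤ M * t) :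
    StronglyStable μ Q := by
  have h1 : ∀ τ, ∫⁻ ω, (Q τ ω : ℝ≥0∞) ∂μ = ENNReal.ofReal (∫ ω, (Q τ ω : ℝ) ∂μ) := by
    intro τ
    rw [ofReal_integral_eq_lintegral_ofReal (hQ τ) (Eventually.of_forall fun ω => by positivity)]
    simp
  have h2 : ∀ᶠ t : ℕ in atTop, (∑ τ ∈ Finset.range t, ∫⁻ ω, (Q τ ω : ℝ≥0∞) ∂μ) / (t : ℝ≥0∞) ≤
      ENNReal.ofReal M := by
    filter_upwards [eventually_gt_atTop 0] with t ht
    refine ENNReal.div_le_of_le_mul ?_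
    simp only [h1]
    rw [← ENNReal.ofReal_sum_of_nonneg fun τ _ => integral_nonneg fun ω => Nat.cast_nonneg _,
      ← ENNReal.ofReal_natCast t, ← ENNReal.ofReal_mul' (Nat.cast_nonneg t)]
    exact ENNReal.ofReal_le_ofReal (hM t ht)
  exact (limsup_le_of_le (by isBoundedDefault) h2).trans_lt ENNReal.ofReal_lt_top

lemma sum_range_mul_le {f g : ℕ → ℝ} {T : ℕ} (h : ∀ j, ∀ k < T, f (T * j + k) ≤ g j) (J : ℕ) :
    ∑ τ ∈ Finset.range (T * J), f τ ≤ T * ∑ j ∈ Finset.range J, g j := by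
  induction J with
  | zero => simp
  | succ J ih =>
    rw [Nat.mul_succ, Finset.sum_range_add, Finset.sum_range_succ, mul_add]
    refine add_le_add ih ?_
    refine (Finset.sum_le_sum fun k hk => h J k (Finset.mem_range.1 hk)).trans ?_
    simp

/-- The Foster–Lyapunov argument: sum the drift inequalities and drop the last, nonnegative value of
`V`. -/
lemma sum_le_of_drift {V e : ℕ → ℝ} {η K : ℝ} (hV : ∀ j, 0 ≤ V j)
    (h : ∀ j, V (j + 1) ≤ V j - η * e j + K) (J : ℕ) :
    η * ∑ j ∈ Finset.range J, e j ≤ V 0 + J * K := by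
  have key : η * ∑ j ∈ Finset.range J, e j ≤ V 0 - V J + J * K := by
    induction J with
    | zero => simp
    | succ J ih =>
      rw [Finset.sum_range_succ, mul_add]
      push_cast
      linarith [h J]
  linarith [hV J]

lemma IsSystemInput.stronglyStable {Ω : Type*} [MeasurableSpace Ω] {μ : Measure Ω}
    [IsProbabilityMeasure μ] {ε : ℝ} {lam : Fin 2 → ℝ} {A : Fin 2 → ℕ → Ω → ℕ}
    {C : Fin 2 → ℕ → Ω → Bool} (hin : IsSystemInput μ ε lam A C) {T : ℕ} (hT : 0 < T)
    (m₀ : Fin 2) (q₀ : Fin 2 → ℕ) {c₀ : ℝ} (hc₀ : 0 ≤ c₀)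
    {H : (Fin 2 → ℕ) → State → ℝ} (hH : ∀ w s, |H w s| ≤ c₀ * ∑ i, (w i : ℝ)) {r : Fin 2 → ℝ}
    (hr : ∀ (w : Fin 2 → ℕ) (s : State), 9 / 10 * ∑ i, (w i : ℝ) * r i ≤
      ∑ i, (w i : ℝ) * reward i s (stayAt ε w s) + ∑ s', stateProb ε s (stayAt ε w s) s' * H w s'
        - H w s) {δ ξ : ℝ} (hδ : 2 * c₀ ≤ T * δ) (hξ : 0 < ξ)
    (hlam : ∀ i, lam i + δ + ξ = 9 / 10 * r i) (i : Fin 2) :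
    StronglyStable μ fun t ω =>
      (myopicRun ε T m₀ q₀ (arrivalPath A ω) (channelPath C ω) t).2 i := by
  obtain ⟨B, hB⟩ := hin.exists_second_moment
  have hcm := hin.measurable_channelPath
  have iQ : ∀ i t, Integrable (fun ω => ((myopicRun ε T m₀ q₀ (arrivalPath A ω) (channelPath C ω)
      t).2 i : ℝ)) μ := fun i t => (hin.memLp_queue T m₀ q₀ hcm t i).integrable (by norm_num)
  have iA : ∀ i t, Integrable (fun ω => (arrivalPath A ω t i : ℝ)) μ := fun i t =>
    (hin.memLp_arrival i t).integrable (by norm_num)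
  -- Arrivals are integers, so a ≤ a² and the second moment also bounds the mean.
  have hA : ∀ i t, ∫ ω, (arrivalPath A ω t i : ℝ) ∂μ ≤ B := fun i t =>
    (integral_mono (iA i t) (hB i t).1 fun ω => by
      have : A i t ω ≤ A i t ω ^ 2 := Nat.le_self_pow two_ne_zero _
      change (A i t ω : ℝ) ≤ (A i t ω : ℝ) ^ 2
      exact_mod_cast this).trans (hB i t).2
  have hB0 : 0 ≤ B := (integral_nonneg fun ω => by positivity).trans (hB 0 0).2
  set V : ℕ → ℝ := fun j => ∑ i, ∫ ω, ((myopicRun ε T m₀ q₀ (arrivalPath A ω) (channelPath C ω)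
    (T * j)).2 i : ℝ) ^ 2 ∂μ
  set e : ℕ → ℝ := fun j => ∑ i, ∫ ω, ((myopicRun ε T m₀ q₀ (arrivalPath A ω) (channelPath C ω)
    (T * j)).2 i : ℝ) ∂μ
  set K : ℝ := 2 * (T ^ 2 * B + 3 * T ^ 2)
  have hK : 0 ≤ K := by positivity
  have hV : ∀ j, 0 ≤ V j := fun j =>
    Finset.sum_nonneg fun i _ => integral_nonneg fun ω => sq_nonneg _
  have hdrift := sum_le_of_drift hV
    (hin.frame_drift T m₀ q₀ hc₀ hH hr hδ hlam (fun i t => (hB i t).2))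
  have hslot : ∀ j, ∀ k < T, ∫ ω, ((myopicRun ε T m₀ q₀ (arrivalPath A ω) (channelPath C ω)
      (T * j + k)).2 i : ℝ) ∂μ ≤ e j + T * B := by
    intro j k hk
    have h1 : ∫ ω, ((myopicRun ε T m₀ q₀ (arrivalPath A ω) (channelPath C ω)
        (T * j + k)).2 i : ℝ) ∂μ ≤ ∫ ω, (((myopicRun ε T m₀ q₀ (arrivalPath A ω)
        (channelPath C ω) (T * j)).2 i : ℝ) +
          ∑ s ∈ Finset.range k, (arrivalPath A ω (T * j + s) i : ℝ)) ∂μ := by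
      refine integral_mono (iQ i _)
        ((iQ i _).add (integrable_finsetSum _ fun s _ => iA i (T * j + s))) fun ω => ?_
      have := queue_le_add ε T m₀ q₀ (arrivalPath A ω) (channelPath C ω) (T * j) k i
      change ((myopicRun ε T m₀ q₀ (arrivalPath A ω) (channelPath C ω) (T * j + k)).2 i : ℝ) ≤ _
      exact_mod_cast this
    rw [integral_add (iQ i _) (integrable_finsetSum _ fun s _ => iA i (T * j + s)),
      integral_finsetSum _ fun s _ => iA i (T * j + s)] at h1
    have h2 : ∑ s ∈ Finset.range k, ∫ ω, (arrivalPath A ω (T * j + s) i : ℝ) ∂μ ≤ T * B := by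
      refine (Finset.sum_le_sum fun s _ => hA i (T * j + s)).trans ?_
      rw [Finset.sum_const, Finset.card_range, nsmul_eq_mul]
      exact mul_le_mul_of_nonneg_right (by exact_mod_cast hk.le) hB0
    have h3 := Finset.single_le_sum (f := fun i => ∫ ω, ((myopicRun ε T m₀ q₀ (arrivalPath A ω)
      (channelPath C ω) (T * j)).2 i : ℝ) ∂μ)
      (fun i _ => integral_nonneg fun ω => Nat.cast_nonneg _) (Finset.mem_univ i)
    exact h1.trans (add_le_add h3 h2)
  -- The first `t` slots lie in J = t/T + 1 ≤ 2t frames, which explains the factor 2 in `M`. The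
  -- drift constant is 2Tξ, so the bound `h3` by a multiple of 1/ξ has a factor 2 to spare.
  refine stronglyStable_of_sum_le (iQ i) (M := V 0 / ξ + 2 * (K / ξ + T ^ 2 * B)) fun t ht => ?_
  set J := t / T + 1 with hJ
  have ht1 : t ≤ T * J := by
    rw [hJ, mul_add, mul_one]
    exact (Nat.div_add_mod t T).symm.le.trans (by have := Nat.mod_lt t hT; omega)
  have hJt : (J : ℝ) ≤ 2 * t := by
    have : t / T ≤ t := Nat.div_le_self _ _
    have : J ≤ 2 * t := by omega
    exact_mod_cast this
  have h1 : ∑ τ ∈ Finset.range t, ∫ ω, ((myopicRun ε T m₀ q₀ (arrivalPath A ω) (channelPath C ω)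
      τ).2 i : ℝ) ∂μ ≤ ∑ τ ∈ Finset.range (T * J), ∫ ω, ((myopicRun ε T m₀ q₀ (arrivalPath A ω)
      (channelPath C ω) τ).2 i : ℝ) ∂μ :=
    Finset.sum_le_sum_of_subset_of_nonneg (Finset.range_subset_range.2 ht1)
      fun τ _ _ => integral_nonneg fun ω => Nat.cast_nonneg _
  have h2 := sum_range_mul_le (f := fun τ => ∫ ω, ((myopicRun ε T m₀ q₀ (arrivalPath A ω)
    (channelPath C ω) τ).2 i : ℝ) ∂μ) (g := fun j => e j + T * B) hslot J
  rw [Finset.sum_add_distrib, Finset.sum_const, Finset.card_range, nsmul_eq_mul] at h2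
  have h3 : T * ∑ j ∈ Finset.range J, e j ≤ (V 0 + J * K) / ξ := by
    rw [le_div_iff₀ hξ]
    have h4 := hdrift J
    have h5 : 0 ≤ V 0 + J * K := add_nonneg (hV 0) (by positivity)
    linarith
  have ht' : (1 : ℝ) ≤ t := by exact_mod_cast ht
  have h6 : V 0 / ξ ≤ V 0 / ξ * t := le_mul_of_one_le_right (div_nonneg (hV 0) hξ.le) ht'
  have h7 : (J : ℝ) * (K / ξ + T ^ 2 * B) ≤ 2 * t * (K / ξ + T ^ 2 * B) :=
    mul_le_mul_of_nonneg_right hJt (by positivity)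
  have h8 : (V 0 + J * K) / ξ = V 0 / ξ + J * (K / ξ) := by ring
  rw [h8] at h3
  linarith

end SwitchingQueues

end

theorem mainTheorem3 (ε : ℝ) (hε₀ : 0 < ε) (hε : ε ≤ 1 / 2) :
    ∃ δ : ℕ → ℝ, StrictAnti δ ∧ Filter.Tendsto δ Filter.atTop (nhds 0) ∧
      ∀ T : ℕ, 0 < T →
      ∀ lam ∈ SwitchingQueues.strictlyInside (9 / 10) (δ T) (SwitchingQueues.rateRegion ε),
      ∀ (Ω : Type*) [MeasurableSpace Ω] (μ : MeasureTheory.Measure Ω)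
        [MeasureTheory.IsProbabilityMeasure μ]
        (A : Fin 2 → ℕ → Ω → ℕ) (C : Fin 2 → ℕ → Ω → Bool),
      SwitchingQueues.IsSystemInput μ ε lam A C →
      ∀ (m₀ : Fin 2) (q₀ : Fin 2 → ℕ) (i : Fin 2),
        SwitchingQueues.StronglyStable μ (fun t ω =>
          (SwitchingQueues.myopicRun ε T m₀ q₀ (fun τ j => A j τ ω) (fun τ j => C j τ ω) t).2 i) := by
  obtain ⟨c, hc, hpot⟩ := SwitchingQueues.exists_potential hε₀ hε
  -- The potentials are chosen before the rate pair, so `c`, and with it δ, depends on ε alone.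
  choose H hH hr using hpot
  -- The frame drift needs 2c ≤ Tδ(T). Here Tδ(T) = 4cT/(T + 1), which is at least 2c as soon as T ≥
  -- 1.
  refine ⟨fun T => 4 * c * (1 / ((T : ℝ) + 1)), fun a b hab => ?_, ?_, ?_⟩
  · have hab' : (a : ℝ) < b := by exact_mod_cast hab
    exact mul_lt_mul_of_pos_left
      (one_div_lt_one_div_of_lt (by positivity) (by linarith)) (by positivity)
  · simpa using tendsto_one_div_add_atTop_nhds_zero_nat.const_mul (4 * c)
  · rintro T hT lam ⟨ξ, hξ, r, hrΛ, hlam⟩ Ω _ μ _ A C hin m₀ q₀ i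
    refine hin.stronglyStable hT m₀ q₀ hc.le hH (fun w s => hr w r hrΛ s) ?_ hξ hlam i
    have hT' : (1 : ℝ) ≤ T := by exact_mod_cast hT
    have : (T : ℝ) * (4 * c * (1 / (T + 1))) = 4 * c * T / (T + 1) := by ring
    rw [this, le_div_iff₀ (by positivity)]
    nlinarith
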